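/- **Gradual type theory.** A *GTT signature* $\Sigma=(\Sigma_0,\Sigma_1,\Sigma_2,\Sigma_3)$ consists of a set $\Sigma_0$ of base types; a set $\Sigma_1$ of pairs of types (type dynamism axioms), where types are generated by $A::=X\in\Sigma_0\mid{?}\mid A\to A\mid A\times A\mid 1$; a set $\Sigma_2$ of function symbols $f$, each with a list of source types and a target type; and a set $\Sigma_3$ of pairs of terms $(\Gamma\vdash t:A,\ \Gamma'\vdash t':A')$ (term dynamism axioms) for which $\Gamma\sqsubseteq\Gamma'$ and $A\sqsubseteq A'$ are derivable. *Type dynamism* $A\sqsubseteq A'$ is the least preorder that contains $\Sigma_1$, has $A\sqsubseteq{?}$ for all $A$, and makes $\to$ and $\times$ monotone in both arguments; contexts (lists of types) are ordered pointwise. *Terms* are variables, applications $f(t_0,\dots)$ of function symbols, $\lambda x{:}A.\,t$, $t\,u$, pairs, projections $\pi_i t$, $()$, errors $\mho_A$, and, whenever $A\sqsubseteq A'$ is derivable, upcasts $\langle A'\leftarrowtail A\rangle t:A'$ of $t:A$ and downcasts $\langle A\twoheadleftarrow A'\rangle t:A$ of $t:A'$. *Term dynamism* $\Phi\vdash t\sqsubseteq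 t':A\sqsubseteq A'$ relates $\Gamma\vdash t:A$ and $\Gamma'\vdash t':A'$, where $\Phi:\Gamma\sqsubseteq\Gamma'$ and $A\sqsubseteq A'$. It is generated by: $\Sigma_3$; reflexivity; transitivity; corresponding variables are related; closure under substitution ($t\sqsubseteq t'$ and pointwise $\gamma\sqsubseteq\gamma'$ give $t[\gamma]\sqsubseteq t'[\gamma']$); monotonicity of $\lambda$, application, pairing and projections (where the component types $A\sqsubseteq A'$, $B\sqsubseteq B'$ are related); the $\beta$ and $\eta$ laws of $\to,\times$ and the $\eta$ law of $1$, in both directions; $\mho_A\sqsubseteq t$ for every $t:A$ in the same context; and, for $A\sqsubseteq A'$, with $x:A$ and $x':A'$, $x\sqsubseteq\langle A'\leftarrowtail A\rangle x$ and $\langle A\twoheadleftarrow A'\rangle x'\sqsubseteq x'$ and $\langle A\twoheadleftarrow A'\rangle\langle A'\leftarrowtail A\rangle x\sqsubseteq x$, and, under $x\sqsubseteq x'$, $\langle A'\leftarrowtail A\rangle x\sqsubseteq x'$ and $x\sqsubseteq\langle A\twoheadleftarrow A'\rangle x'$. **GTT categories.** A *cartesian preorder multicategory* (CPM) $\mathbb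 C$ has a preordered set $\mathbb C_0$ of objects; a preordered set $\mathbb C_1$ of multiarrows with monotone source (a list of objects, ordered pointwise) and target; monotone projections $x(\Gamma;A;\Delta):\Gamma,A,\Delta\to A$; and a monotone composition $f\circ\gamma$ of a multiarrow $f\in\mathbb C(\Gamma;A)$ with a substitution $\gamma$ (a family of multiarrows $\Delta\to A_i$ for the entries $A_i$ of $\Gamma$, ordered pointwise), subject to the identity, projection and associativity laws. Write $f\sqsupseteq\sqsubseteq g$ for $f\sqsubseteq g\sqsubseteq f$. For $A\sqsubseteq A'$, an *upcast* is $u\in\mathbb C(A;A')$ with $\mathrm{id}_A\sqsubseteq u\sqsubseteq\mathrm{id}_{A'}$, and a *downcast* is $d\in\mathbb C(A';A)$ with $\mathrm{id}_A\sqsubseteq d\sqsubseteq\mathrm{id}_{A'}$. A *GTT category* is a CPM such that: upcasts and downcasts exist for every $A\sqsubseteq A'$, and $d\circ u\sqsubseteq\mathrm{id}_A$ (coreflective equipment); each hom-set $\mathbb C(\Gamma;A)$ has a least element, and $b\circ\gamma$ is least whenever $b$ is (local bottoms); and it comes with a chosen greatest object $\top$ and chosen cartesian closed structure: monotone operations $\to$,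 $\times$ on objects and an object $1$; monotone, substitution-natural maps $\lambda:\mathbb C(\Gamma,A;B)\to\mathbb C(\Gamma;A\to B)$ and $\mathrm{pair}:\mathbb C(\Gamma;A)\times\mathbb C(\Gamma;B)\to\mathbb C(\Gamma;A\times B)$, and multiarrows $\mathrm{app}\in\mathbb C(A\to B,A;B)$, $\pi_1\in\mathbb C(A\times B;A)$, $\pi_2\in\mathbb C(A\times B;B)$ monotone in $(A,B)$, such that $f\mapsto\mathrm{app}\circ(f\circ\mathrm{wkn},x)$ is inverse to $\lambda$ and $f\mapsto(\pi_1\circ f,\pi_2\circ f)$ is inverse to $\mathrm{pair}$; and $\mathbb C(\Gamma;1)$ is a singleton $\{\mathrm{unit}\}$. A *morphism of GTT categories* is a pair of monotone maps on objects and on multiarrows that preserves source, target, projections, composition, $\top$, $\to$, $\lambda$, $\mathrm{app}$, $\times$, $\mathrm{pair}$, $\pi_i$, $1$ and $\mathrm{unit}$ on the nose, and sends least elements of hom-sets to least elements. **Interpretations.** Fix a GTT category $\mathbb C$ with a choice of upcasts, downcasts and least elements $\bot$ of hom-sets. An *interpretation* of $\Sigma$ in $\mathbb C$ assigns to each base type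 an object and to each function symbol a multiarrow of the denoted source and target, so that all axioms of $\Sigma_1$ and $\Sigma_3$ hold in $\mathbb C$. Here $[\![-]\!]$ is extended to all types (with $[\![?]\!]=\top$) and to all terms in the evident way (casts by the chosen upcasts and downcasts, $\mho$ by $\bot$, $\lambda$, application, pairs, projections and $()$ by the cartesian closed structure). **Theorem.** 1. *(Soundness.)* For every interpretation of $\Sigma$ in a GTT category: each $[\![A]\!]$ is an object; if $A\sqsubseteq A'$ is derivable then $[\![A]\!]\sqsubseteq[\![A']\!]$; for each $\Gamma\vdash t:A$, $[\![t]\!]$ is a multiarrow with source $[\![\Gamma]\!]$ and target $[\![A]\!]$; and if $\Phi\vdash t\sqsubseteq t':A\sqsubseteq A'$ is derivable then $[\![t]\!]\sqsubseteq[\![t']\!]$. 2. *(Completeness.)* If $[\![A]\!]\sqsubseteq[\![A']\!]$ in every interpretation of $\Sigma$, then $A\sqsubseteq A'$ is derivable. If $\Phi:\Gamma\sqsubseteq\Gamma'$, $A\sqsubseteq A'$, $\Gamma\vdash t:A$, $\Gamma'\vdash t':A'$, and $[\![t]\!]\sqsubseteq[\![t']\!]$ in every interpretation of $\Sigma$,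 then $\Phi\vdash t\sqsubseteq t':A\sqsubseteq A'$ is derivable. 3. *(Initiality.)* A *translation* $\Sigma\to\Theta$ of signatures maps base types to base types and function symbols to function symbols of the translated type, and sends axioms to axioms; this gives the category $\mathrm{GttS}$. Let $\mathrm{GttC}$ be the category of GTT categories and their morphisms. The *complete signature* $U\mathbb C$ has as base types the objects of $\mathbb C$; as type dynamism axioms all pairs of types over these whose denotations in $\mathbb C$ are ordered; as function symbols from $\Gamma$ to $A$ (formal types over the objects of $\mathbb C$) all multiarrows in $\mathbb C([\![\Gamma]\!];[\![A]\!])$; and as term dynamism axioms all pairs of terms over these, of related contexts and types, whose denotations are ordered. Let $GTT(\Sigma)$ have as objects the types over $\Sigma$ and as multiarrows the terms modulo $\beta\eta$-equality, with composition given by substitution and both orders by derivability. Then $GTT(\Sigma)$ is a GTT category, and $GTT:\mathrm{GttS}\to\mathrm{GttC}$ (acting by translation of types and terms) and $U:\mathrm{GttC}\to\mathrm{GttS}$ (acting by $F$ on objects and multiarrows) are functors. There is a natural transformation $\eta_\Sigma:\Sigma\to U(GTT(\Sigma))$ with $\eta(X)=X$ and $\eta(f)=f(x_0,\dots)$. It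 is universal up to order-equivalence on arrows: for every GTT category $\mathbb C$ and translation $i:\Sigma\to U\mathbb C$ there is a morphism $F:GTT(\Sigma)\to\mathbb C$ with $U(F)\circ\eta_\Sigma=i$, which agrees with the interpretation $[\![-]\!]$ given by $i$ (equal on objects, order-equivalent on terms for any choice of casts and bottoms); and any morphism $F'$ such that $U(F')\circ\eta_\Sigma$ equals $i$ on base types and is order-equivalent to $i$ on function symbols equals $F$ on objects and satisfies $F'(f)\sqsupseteq\sqsubseteq F(f)$ for all multiarrows $f$. -/

import Mathlib

open CategoryTheory

universe u w

namespace GTT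

/-! ## Types, contexts and variables

Contexts are lists of types; variables are de Bruijn positions.  The head of the list is the most
recently bound variable, so the context written `Γ, x : A` on paper is the list `A :: Γ`. -/

/-- The types of gradual type theory over a set `B` of base types. -/
inductive Ty (B : Type u) : Type u
  | base (X : B) : Ty B
  | dyn : Ty B
  | fn (A₁ A₂ : Ty B) : Ty B
  | prod (A₁ A₂ : Ty B) : Ty B
  | one : Ty B

/-- Renaming of base types. -/
def Ty.map {B : Type u} {B' : Type w} (i : B → B') : Ty B → Ty B'
  | .base X => .base (i X)
  | .dyn => .dyn
  | .fn A₁ A₂ => .fn (A₁.map i) (A₂.map i)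
  | .prod A₁ A₂ => .prod (A₁.map i) (A₂.map i)
  | .one => .one

/-- `Var Γ A` is the type of positions in the list `Γ` at which `A` stands. -/
inductive Var {O : Type u} : List O → O → Type u
  | z {Γ : List O} {A : O} : Var (A :: Γ) A
  | s {Γ : List O} {A B : O} (x : Var Γ A) : Var (B :: Γ) A

namespace Var

/-- The position as a number, used to say that variables of two contexts correspond. -/
def idx {O : Type u} : {Γ : List O} → {A : O} → Var Γ A → ℕ
  | _, _, .z => 0
  | _, _, .s x => x.idx + 1

/-- The position corresponding to `x` after a function is applied to all entries of the list. -/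
def map {O : Type u} {O' : Type w} (F : O → O') :
    {Γ : List O} → {A : O} → Var Γ A → Var (Γ.map F) (F A)
  | _, _, .z => .z
  | _, _, .s x => .s (x.map F)

/-- The empty family. -/
def nil {O : Type u} {P : O → Type w} : ∀ B, Var ([] : List O) B → P B :=
  fun _ x => nomatch x

/-- Extension of a family indexed by the positions of `Γ` to the positions of `A :: Γ`. -/
def cons {O : Type u} {P : O → Type w} {Γ : List O} {A : O} (p : P A)
    (γ : ∀ B, Var Γ B → P B) : ∀ B, Var (A :: Γ) B → P B
  | _, .z => p
  | _, .s x => γ _ x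

/-- Reindexing of a family along `F`: the entry at position `i` of the result is the entry at
position `i` of the given family. -/
def mapAll {O : Type u} {O' : Type w} (F : O → O') {P : O' → Type*} :
    {Γ : List O} → (∀ A, Var Γ A → P (F A)) → ∀ B, Var (Γ.map F) B → P B
  | [], _ => nil
  | _ :: _, a => cons (a _ .z) (mapAll F fun A x => a A (.s x))

end Var

/-! ## Signatures, terms and the dynamism judgments -/

/-- The first three layers of a signature: base types, type dynamism axioms (pairs of types),
and function symbols with a list of source types and a target type. -/
structure PreSig : Type (u + 1) where
  Base : Type u
  tyAx : Ty Base → Ty Base → Prop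
  Sym : Type u
  src : Sym → List (Ty Base)
  tgt : Sym → Ty Base

namespace PreSig

/-- Contexts. -/
abbrev Ctx (S : PreSig.{u}) : Type u := List (Ty S.Base)

/-- The set of function symbols with given source and target. -/
def SymHom (S : PreSig.{u}) (Δ : S.Ctx) (A : Ty S.Base) : Type u :=
  { f : S.Sym // S.src f = Δ ∧ S.tgt f = A }

/-- Derivability of type dynamism `A ⊑ A'`. -/
inductive TyDyn (S : PreSig.{u}) : Ty S.Base → Ty S.Base → Prop
  | refl (A) : TyDyn S A A
  | trans {A A' A''} : TyDyn S A A' → TyDyn S A' A'' → TyDyn S A A''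
  | ax {A A'} : S.tyAx A A' → TyDyn S A A'
  | dynTop (A) : TyDyn S A .dyn
  | fnMon {A A' B B'} : TyDyn S A A' → TyDyn S B B' → TyDyn S (.fn A B) (.fn A' B')
  | prodMon {A A' B B'} : TyDyn S A A' → TyDyn S B B' → TyDyn S (.prod A B) (.prod A' B')

/-- Context dynamism `Γ ⊑ Γ'`: same length and pointwise type dynamism. -/
def CtxDyn (S : PreSig.{u}) (Γ Γ' : S.Ctx) : Prop := List.Forall₂ S.TyDyn Γ Γ'

/-- Intrinsically typed terms `Γ ⊢ t : A`. -/
inductive Tm (S : PreSig.{u}) : S.Ctx → Ty S.Base → Type u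
  | var {Γ A} (x : Var Γ A) : Tm S Γ A
  | sym {Γ Δ A} (f : S.SymHom Δ A) (args : ∀ B, Var Δ B → Tm S Γ B) : Tm S Γ A
  | up {Γ A A'} (h : S.TyDyn A A') (t : Tm S Γ A) : Tm S Γ A'
  | dn {Γ A A'} (h : S.TyDyn A A') (t : Tm S Γ A') : Tm S Γ A
  | err {Γ} (A) : Tm S Γ A
  | lam {Γ A B} (t : Tm S (A :: Γ) B) : Tm S Γ (.fn A B)
  | ap {Γ A B} (t : Tm S Γ (.fn A B)) (v : Tm S Γ A) : Tm S Γ B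
  | pair {Γ A B} (t₁ : Tm S Γ A) (t₂ : Tm S Γ B) : Tm S Γ (.prod A B)
  | fst {Γ A B} (t : Tm S Γ (.prod A B)) : Tm S Γ A
  | snd {Γ A B} (t : Tm S Γ (.prod A B)) : Tm S Γ B
  | unit {Γ} : Tm S Γ .one

namespace Tm

variable {S : PreSig.{u}}

/-- Renaming of variables. -/
def rename : {Γ Δ : S.Ctx} → {A : Ty S.Base} → (∀ B, Var Γ B → Var Δ B) → S.Tm Γ A → S.Tm Δ A
  | _, _, _, ρ, .var x => .var (ρ _ x)
  | _, _, _, ρ, .sym f args => .sym f fun B x => (args B x).rename ρ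
  | _, _, _, ρ, .up h t => .up h (t.rename ρ)
  | _, _, _, ρ, .dn h t => .dn h (t.rename ρ)
  | _, _, _, _, .err A => .err A
  | _, _, _, ρ, .lam t => .lam (t.rename (Var.cons .z fun B x => .s (ρ B x)))
  | _, _, _, ρ, .ap t v => .ap (t.rename ρ) (v.rename ρ)
  | _, _, _, ρ, .pair t₁ t₂ => .pair (t₁.rename ρ) (t₂.rename ρ)
  | _, _, _, ρ, .fst t => .fst (t.rename ρ)
  | _, _, _, ρ, .snd t => .snd (t.rename ρ)
  | _, _, _, _, .unit => .unit

/-- Weakening by one variable. -/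
def wk {Γ : S.Ctx} {A B : Ty S.Base} (t : S.Tm Γ A) : S.Tm (B :: Γ) A :=
  t.rename fun _ x => .s x

/-- Simultaneous capture-avoiding substitution `t[γ]`. -/
def subst : {Γ Δ : S.Ctx} → {A : Ty S.Base} → S.Tm Γ A → (∀ B, Var Γ B → S.Tm Δ B) → S.Tm Δ A
  | _, _, _, .var x, γ => γ _ x
  | _, _, _, .sym f args, γ => .sym f fun B x => (args B x).subst γ
  | _, _, _, .up h t, γ => .up h (t.subst γ)
  | _, _, _, .dn h t, γ => .dn h (t.subst γ)
  | _, _, _, .err A, _ => .err A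
  | _, _, _, .lam t, γ => .lam (t.subst (Var.cons (.var .z) fun B x => (γ B x).wk))
  | _, _, _, .ap t v, γ => .ap (t.subst γ) (v.subst γ)
  | _, _, _, .pair t₁ t₂, γ => .pair (t₁.subst γ) (t₂.subst γ)
  | _, _, _, .fst t, γ => .fst (t.subst γ)
  | _, _, _, .snd t, γ => .snd (t.subst γ)
  | _, _, _, .unit, _ => .unit

/-- Substitution for the last variable, `t[v/x]`. -/
def inst {Γ : S.Ctx} {A B : Ty S.Base} (t : S.Tm (A :: Γ) B) (v : S.Tm Γ A) : S.Tm Γ B :=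
  t.subst (Var.cons v fun _ x => .var x)

end Tm

/-- The `β` and `η` laws for function, product and unit types. -/
inductive Conv (S : PreSig.{u}) : {Γ : S.Ctx} → {A : Ty S.Base} → S.Tm Γ A → S.Tm Γ A → Prop
  | fnBeta {Γ A B} (t : S.Tm (A :: Γ) B) (v : S.Tm Γ A) : Conv S (.ap (.lam t) v) (t.inst v)
  | fnEta {Γ A B} (t : S.Tm Γ (.fn A B)) : Conv S t (.lam (.ap t.wk (.var .z)))
  | fstBeta {Γ A B} (t₁ : S.Tm Γ A) (t₂ : S.Tm Γ B) : Conv S (.fst (.pair t₁ t₂)) t₁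
  | sndBeta {Γ A B} (t₁ : S.Tm Γ A) (t₂ : S.Tm Γ B) : Conv S (.snd (.pair t₁ t₂)) t₂
  | prodEta {Γ A B} (t : S.Tm Γ (.prod A B)) : Conv S t (.pair (.fst t) (.snd t))
  | oneEta {Γ} (t : S.Tm Γ .one) : Conv S t .unit

/-- `βη`-equality of terms: the congruence generated by the `β` and `η` laws. -/
inductive TmEq (S : PreSig.{u}) : {Γ : S.Ctx} → {A : Ty S.Base} → S.Tm Γ A → S.Tm Γ A → Prop
  | conv {Γ A} {t t' : S.Tm Γ A} : S.Conv t t' → TmEq S t t'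
  | refl {Γ A} (t : S.Tm Γ A) : TmEq S t t
  | symm {Γ A} {t t' : S.Tm Γ A} : TmEq S t t' → TmEq S t' t
  | trans {Γ A} {t t' t'' : S.Tm Γ A} : TmEq S t t' → TmEq S t' t'' → TmEq S t t''
  | sym {Γ Δ A} (f : S.SymHom Δ A) {a a' : ∀ B, Var Δ B → S.Tm Γ B} :
      (∀ B x, TmEq S (a B x) (a' B x)) → TmEq S (.sym f a) (.sym f a')
  | up {Γ A A'} (h : S.TyDyn A A') {t t' : S.Tm Γ A} : TmEq S t t' → TmEq S (.up h t) (.up h t')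
  | dn {Γ A A'} (h : S.TyDyn A A') {t t' : S.Tm Γ A'} : TmEq S t t' → TmEq S (.dn h t) (.dn h t')
  | lam {Γ A B} {t t' : S.Tm (A :: Γ) B} : TmEq S t t' → TmEq S (.lam t) (.lam t')
  | ap {Γ A B} {t t' : S.Tm Γ (.fn A B)} {v v' : S.Tm Γ A} :
      TmEq S t t' → TmEq S v v' → TmEq S (.ap t v) (.ap t' v')
  | pair {Γ A B} {t t' : S.Tm Γ A} {v v' : S.Tm Γ B} :
      TmEq S t t' → TmEq S v v' → TmEq S (.pair t v) (.pair t' v')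
  | fst {Γ A B} {t t' : S.Tm Γ (.prod A B)} : TmEq S t t' → TmEq S (.fst t) (.fst t')
  | snd {Γ A B} {t t' : S.Tm Γ (.prod A B)} : TmEq S t t' → TmEq S (.snd t) (.snd t')

/-- The set of all terms, in all contexts and of all types. -/
abbrev Tot (S : PreSig.{u}) : Type u := Σ (Γ : S.Ctx) (A : Ty S.Base), S.Tm Γ A

/-- A term as an element of the set of all terms. -/
def Tm.tot {S : PreSig.{u}} {Γ : S.Ctx} {A : Ty S.Base} (t : S.Tm Γ A) : S.Tot := ⟨Γ, A, t⟩

end PreSig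

/-- A GTT signature: base types, type dynamism axioms, function symbols, and term dynamism axioms
between terms whose contexts and types are derivably related. -/
structure GttSig : Type (u + 1) extends PreSig.{u} where
  tmAx : toPreSig.Tot → toPreSig.Tot → Prop
  tmAx_ctx : ∀ t t', tmAx t t' → toPreSig.CtxDyn t.1 t'.1
  tmAx_ty : ∀ t t', tmAx t t' → toPreSig.TyDyn t.2.1 t'.2.1

namespace GttSig

/-- Derivability of term dynamism `Φ ⊢ t ⊑ t' : A ⊑ A'`.  The dynamism context `Φ : Γ ⊑ Γ'` is
determined by the contexts of the two terms, and corresponding variables are those at the same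
position. -/
inductive TmDyn (S : GttSig.{u}) :
    {Γ Γ' : S.Ctx} → {A A' : Ty S.Base} → S.Tm Γ A → S.Tm Γ' A' → Prop
  | var {Γ Γ' A A'} {x : Var Γ A} {x' : Var Γ' A'} :
      S.CtxDyn Γ Γ' → x.idx = x'.idx → TmDyn S (.var x) (.var x')
  | comp {Γ Γ' Δ Δ' A A'} {t : S.Tm Γ A} {t' : S.Tm Γ' A'}
      {γ : ∀ B, Var Γ B → S.Tm Δ B} {γ' : ∀ B, Var Γ' B → S.Tm Δ' B} :
      TmDyn S t t' → S.CtxDyn Δ Δ' →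
      (∀ B B' (x : Var Γ B) (x' : Var Γ' B'), x.idx = x'.idx → TmDyn S (γ B x) (γ' B' x')) →
      TmDyn S (t.subst γ) (t'.subst γ')
  | refl {Γ A} (t : S.Tm Γ A) : TmDyn S t t
  | trans {Γ Γ' Γ'' A A' A''} {t : S.Tm Γ A} {t' : S.Tm Γ' A'} {t'' : S.Tm Γ'' A''} :
      TmDyn S t t' → TmDyn S t' t'' → TmDyn S t t''
  | ax {Γ Γ' A A'} {t : S.Tm Γ A} {t' : S.Tm Γ' A'} : S.tmAx t.tot t'.tot → TmDyn S t t'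
  | upR {A A'} (h : S.TyDyn A A') :
      TmDyn S (.var .z : S.Tm [A] A) (.up h (.var .z) : S.Tm [A] A')
  | upL {A A'} (h : S.TyDyn A A') :
      TmDyn S (.up h (.var .z) : S.Tm [A] A') (.var .z : S.Tm [A'] A')
  | dnL {A A'} (h : S.TyDyn A A') :
      TmDyn S (.dn h (.var .z) : S.Tm [A'] A) (.var .z : S.Tm [A'] A')
  | dnR {A A'} (h : S.TyDyn A A') :
      TmDyn S (.var .z : S.Tm [A] A) (.dn h (.var .z) : S.Tm [A'] A)
  | retract {A A'} (h : S.TyDyn A A') :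
      TmDyn S (.dn h (.up h (.var .z)) : S.Tm [A] A) (.var .z : S.Tm [A] A)
  | errBot {Γ A} (t : S.Tm Γ A) : TmDyn S (.err A : S.Tm Γ A) t
  | lamMon {Γ Γ' A A' B B'} {t : S.Tm (A :: Γ) B} {t' : S.Tm (A' :: Γ') B'} :
      TmDyn S t t' → TmDyn S (.lam t) (.lam t')
  | apMon {Γ Γ' A A' B B'} {t : S.Tm Γ (.fn A B)} {t' : S.Tm Γ' (.fn A' B')}
      {v : S.Tm Γ A} {v' : S.Tm Γ' A'} : S.TyDyn A A' → S.TyDyn B B' →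
      TmDyn S t t' → TmDyn S v v' → TmDyn S (.ap t v) (.ap t' v')
  | pairMon {Γ Γ' A A' B B'} {t : S.Tm Γ A} {t' : S.Tm Γ' A'}
      {v : S.Tm Γ B} {v' : S.Tm Γ' B'} :
      TmDyn S t t' → TmDyn S v v' → TmDyn S (.pair t v) (.pair t' v')
  | fstMon {Γ Γ' A A' B B'} {t : S.Tm Γ (.prod A B)} {t' : S.Tm Γ' (.prod A' B')} :
      S.TyDyn A A' → S.TyDyn B B' → TmDyn S t t' → TmDyn S (.fst t) (.fst t')
  | sndMon {Γ Γ' A A' B B'} {t : S.Tm Γ (.prod A B)} {t' : S.Tm Γ' (.prod A' B')} :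
      S.TyDyn A A' → S.TyDyn B B' → TmDyn S t t' → TmDyn S (.snd t) (.snd t')
  | conv {Γ A} {t t' : S.Tm Γ A} : S.Conv t t' → TmDyn S t t'
  | convSymm {Γ A} {t t' : S.Tm Γ A} : S.Conv t t' → TmDyn S t' t

end GttSig

/-! ## Cartesian preorder multicategories and GTT categories -/

/-- Two sets with relations (the orders on objects and on multiarrows), and the source and target
functions of a multicategory. -/
structure PreMulti : Type (u + 1) where
  Obj : Type u
  Arr : Type u
  objLE : Obj → Obj → Prop
  arrLE : Arr → Arr → Prop
  src : Arr → List Obj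
  tgt : Arr → Obj

namespace PreMulti

/-- The hom-set of multiarrows with source `Γ` and target `A`. -/
def Hom (C : PreMulti.{u}) (Γ : List C.Obj) (A : C.Obj) : Type u :=
  { f : C.Arr // C.src f = Γ ∧ C.tgt f = A }

/-- Substitutions from `Δ` to `Γ`: a multiarrow from `Δ` to each entry of `Γ`. -/
abbrev Sub (C : PreMulti.{u}) (Δ Γ : List C.Obj) : Type u := ∀ B, Var Γ B → C.Hom Δ B

/-- The pointwise order on contexts. -/
def CtxLE (C : PreMulti.{u}) (Γ Γ' : List C.Obj) : Prop := List.Forall₂ C.objLE Γ Γ'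

/-- The order between multiarrows of possibly different sources and targets. -/
def LE (C : PreMulti.{u}) {Γ Γ' : List C.Obj} {A A' : C.Obj} (f : C.Hom Γ A) (g : C.Hom Γ' A') :
    Prop := C.arrLE f.1 g.1

/-- The pointwise order on substitutions. -/
def SubLE (C : PreMulti.{u}) {Δ Δ' Γ Γ' : List C.Obj} (γ : C.Sub Δ Γ) (γ' : C.Sub Δ' Γ') : Prop :=
  C.CtxLE Δ Δ' ∧ C.CtxLE Γ Γ' ∧
    ∀ B B' (x : Var Γ B) (x' : Var Γ' B'), x.idx = x'.idx → C.LE (γ B x) (γ' B' x')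

/-- Order-equivalence of multiarrows. -/
def ArrEquiv (C : PreMulti.{u}) (f g : C.Arr) : Prop := C.arrLE f g ∧ C.arrLE g f

/-- A least element of a hom-set. -/
def IsBot (C : PreMulti.{u}) {Γ : List C.Obj} {A : C.Obj} (b : C.Hom Γ A) : Prop :=
  ∀ f : C.Hom Γ A, C.LE b f

end PreMulti

/-- The operations of a multicategory: projections and composition with substitutions. -/
structure MultiData : Type (u + 1) extends PreMulti.{u} where
  proj {Γ : List Obj} {A : Obj} : Var Γ A → toPreMulti.Hom Γ A
  comp {Γ Δ : List Obj} {A : Obj} : toPreMulti.Hom Γ A → toPreMulti.Sub Δ Γ → toPreMulti.Hom Δ A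

namespace MultiData

/-- The identity multiarrow. -/
def ident (C : MultiData.{u}) (A : C.Obj) : C.Hom [A] A := C.proj .z

/-- The identity substitution. -/
def identSub (C : MultiData.{u}) (Γ : List C.Obj) : C.Sub Γ Γ := fun _ x => C.proj x

/-- Composition of substitutions. -/
def compSub (C : MultiData.{u}) {Θ Δ Γ : List C.Obj} (γ : C.Sub Δ Γ) (δ : C.Sub Θ Δ) : C.Sub Θ Γ :=
  fun B x => C.comp (γ B x) δ

/-- The weakening substitution. -/
def wkn (C : MultiData.{u}) (Γ : List C.Obj) (A : C.Obj) : C.Sub (A :: Γ) Γ :=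
  fun _ x => C.proj (.s x)

/-- The substitution with one entry. -/
def sub1 (C : MultiData.{u}) {Δ : List C.Obj} {A : C.Obj} (f : C.Hom Δ A) : C.Sub Δ [A] :=
  Var.cons f Var.nil

/-- The substitution with two entries, `f` for the last variable and `g` for the one before. -/
def sub2 (C : MultiData.{u}) {Δ : List C.Obj} {A B : C.Obj} (f : C.Hom Δ A) (g : C.Hom Δ B) :
    C.Sub Δ [A, B] := Var.cons f (Var.cons g Var.nil)

/-- The extension `(γ, x)` of a substitution by the last variable. -/
def liftSub (C : MultiData.{u}) {Δ Γ : List C.Obj} (γ : C.Sub Δ Γ) (A : C.Obj) :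
    C.Sub (A :: Δ) (A :: Γ) := Var.cons (C.proj .z) (C.compSub γ (C.wkn Δ A))

/-- `u` is an upcast for `A ⊑ A'`. -/
def IsUpcast (C : MultiData.{u}) {A A' : C.Obj} (f : C.Hom [A] A') : Prop :=
  C.LE f (C.ident A') ∧ C.LE (C.ident A) f

/-- `d` is a downcast for `A ⊑ A'`. -/
def IsDowncast (C : MultiData.{u}) {A A' : C.Obj} (d : C.Hom [A'] A) : Prop :=
  C.LE d (C.ident A') ∧ C.LE (C.ident A) d

/-- The laws of a cartesian preorder multicategory (CPM). -/
structure IsCpm (C : MultiData.{u}) : Prop where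
  obj_refl : ∀ A, C.objLE A A
  obj_trans : ∀ A A' A'', C.objLE A A' → C.objLE A' A'' → C.objLE A A''
  arr_refl : ∀ f, C.arrLE f f
  arr_trans : ∀ f g h, C.arrLE f g → C.arrLE g h → C.arrLE f h
  src_mono : ∀ f g, C.arrLE f g → C.CtxLE (C.src f) (C.src g)
  tgt_mono : ∀ f g, C.arrLE f g → C.objLE (C.tgt f) (C.tgt g)
  proj_mono : ∀ {Γ Γ' A A'} (x : Var Γ A) (x' : Var Γ' A'),
    C.CtxLE Γ Γ' → x.idx = x'.idx → C.LE (C.proj x) (C.proj x')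
  comp_mono : ∀ {Γ Γ' Δ Δ' A A'} (f : C.Hom Γ A) (f' : C.Hom Γ' A') (γ : C.Sub Δ Γ)
    (γ' : C.Sub Δ' Γ'), C.LE f f' → C.SubLE γ γ' → C.LE (C.comp f γ) (C.comp f' γ')
  comp_ident : ∀ {Γ A} (f : C.Hom Γ A), C.comp f (C.identSub Γ) = f
  proj_comp : ∀ {Γ Δ A} (x : Var Γ A) (γ : C.Sub Δ Γ), C.comp (C.proj x) γ = γ A x
  assoc : ∀ {Γ Δ Θ A} (f : C.Hom Γ A) (γ : C.Sub Δ Γ) (δ : C.Sub Θ Δ),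
    C.comp (C.comp f γ) δ = C.comp f (C.compSub γ δ)

end MultiData

/-- The chosen structure of a GTT category: a greatest object, exponentials, products, unit. -/
structure GttData : Type (u + 1) extends MultiData.{u} where
  top : Obj
  fn : Obj → Obj → Obj
  lam {Γ : List Obj} {A B : Obj} :
    toPreMulti.Hom (A :: Γ) B → toPreMulti.Hom Γ (fn A B)
  app (A B : Obj) : toPreMulti.Hom [A, fn A B] B
  prod : Obj → Obj → Obj
  pair {Γ : List Obj} {A B : Obj} :
    toPreMulti.Hom Γ A → toPreMulti.Hom Γ B → toPreMulti.Hom Γ (prod A B)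
  fst (A B : Obj) : toPreMulti.Hom [prod A B] A
  snd (A B : Obj) : toPreMulti.Hom [prod A B] B
  one : Obj
  unit (Γ : List Obj) : toPreMulti.Hom Γ one

namespace GttData

/-- The map inverse to `lam`: `f` goes to `app ∘ (f ∘ wkn, x)`. -/
def unlam (C : GttData.{u}) {Γ : List C.Obj} {A B : C.Obj} (f : C.Hom Γ (C.fn A B)) :
    C.Hom (A :: Γ) B :=
  C.comp (C.app A B) (C.sub2 (C.proj .z) (C.comp f (C.wkn Γ A)))

/-- The laws of a GTT category: a cartesian closed CPM that is a coreflective equipment and has a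
greatest object and local bottoms.  Casts and local bottoms are required to exist; exponentials,
products, unit and greatest object are chosen. -/
structure IsGttCat (C : GttData.{u}) : Prop extends C.IsCpm where
  le_top : ∀ A, C.objLE A C.top
  fn_mono : ∀ A A' B B', C.objLE A A' → C.objLE B B' → C.objLE (C.fn A B) (C.fn A' B')
  lam_mono : ∀ {Γ Γ' A A' B B'} (f : C.Hom (A :: Γ) B) (f' : C.Hom (A' :: Γ') B'),
    C.LE f f' → C.LE (C.lam f) (C.lam f')
  app_mono : ∀ A A' B B', C.objLE A A' → C.objLE B B' → C.LE (C.app A B) (C.app A' B')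
  lam_natural : ∀ {Γ Δ A B} (f : C.Hom (A :: Γ) B) (γ : C.Sub Δ Γ),
    C.comp (C.lam f) γ = C.lam (C.comp f (C.liftSub γ A))
  unlam_lam : ∀ {Γ A B} (f : C.Hom (A :: Γ) B), C.unlam (C.lam f) = f
  lam_unlam : ∀ {Γ A B} (f : C.Hom Γ (C.fn A B)), C.lam (C.unlam f) = f
  prod_mono : ∀ A A' B B', C.objLE A A' → C.objLE B B' → C.objLE (C.prod A B) (C.prod A' B')
  pair_mono : ∀ {Γ Γ' A A' B B'} (f : C.Hom Γ A) (f' : C.Hom Γ' A') (g : C.Hom Γ B)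
    (g' : C.Hom Γ' B'), C.LE f f' → C.LE g g' → C.LE (C.pair f g) (C.pair f' g')
  fst_mono : ∀ A A' B B', C.objLE A A' → C.objLE B B' → C.LE (C.fst A B) (C.fst A' B')
  snd_mono : ∀ A A' B B', C.objLE A A' → C.objLE B B' → C.LE (C.snd A B) (C.snd A' B')
  pair_natural : ∀ {Γ Δ A B} (f : C.Hom Γ A) (g : C.Hom Γ B) (γ : C.Sub Δ Γ),
    C.comp (C.pair f g) γ = C.pair (C.comp f γ) (C.comp g γ)
  fst_pair : ∀ {Γ A B} (f : C.Hom Γ A) (g : C.Hom Γ B),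
    C.comp (C.fst A B) (C.sub1 (C.pair f g)) = f
  snd_pair : ∀ {Γ A B} (f : C.Hom Γ A) (g : C.Hom Γ B),
    C.comp (C.snd A B) (C.sub1 (C.pair f g)) = g
  pair_fst_snd : ∀ {Γ A B} (f : C.Hom Γ (C.prod A B)),
    C.pair (C.comp (C.fst A B) (C.sub1 f)) (C.comp (C.snd A B) (C.sub1 f)) = f
  unit_natural : ∀ {Γ Δ} (γ : C.Sub Δ Γ), C.comp (C.unit Γ) γ = C.unit Δ
  unit_unique : ∀ {Γ} (f : C.Hom Γ C.one), f = C.unit Γ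
  exists_upcast : ∀ A A', C.objLE A A' → ∃ f : C.Hom [A] A', C.IsUpcast f
  exists_downcast : ∀ A A', C.objLE A A' → ∃ d : C.Hom [A'] A, C.IsDowncast d
  coreflective : ∀ A A' (f : C.Hom [A] A') (d : C.Hom [A'] A), C.objLE A A' →
    C.IsUpcast f → C.IsDowncast d → C.LE (C.comp d (C.sub1 f)) (C.ident A)
  exists_bot : ∀ Γ A, ∃ b : C.Hom Γ A, C.IsBot b
  bot_comp : ∀ {Γ Δ A} (b : C.Hom Γ A) (γ : C.Sub Δ Γ), C.IsBot b → C.IsBot (C.comp b γ)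

/-- The extension of an assignment of objects to base types to all types. -/
def ty (C : GttData.{u}) {B : Type w} (b : B → C.Obj) : Ty B → C.Obj
  | .base X => b X
  | .dyn => C.top
  | .fn A₁ A₂ => C.fn (C.ty b A₁) (C.ty b A₂)
  | .prod A₁ A₂ => C.prod (C.ty b A₁) (C.ty b A₂)
  | .one => C.one

end GttData

/-- A GTT category. -/
structure GttCat : Type (u + 1) extends GttData.{u} where
  laws : toGttData.IsGttCat

/-- The object and arrow parts of a functor of multicategories, preserving source and target. -/
structure PreFunctor (C : PreMulti.{u}) (D : PreMulti.{w}) where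
  obj : C.Obj → D.Obj
  arr : C.Arr → D.Arr
  src : ∀ f, D.src (arr f) = (C.src f).map obj
  tgt : ∀ f, D.tgt (arr f) = obj (C.tgt f)

namespace PreFunctor

variable {C : PreMulti.{u}} {D : PreMulti.{w}}

/-- The action on a hom-set. -/
def hom (F : PreFunctor C D) {Γ : List C.Obj} {A : C.Obj} (f : C.Hom Γ A) :
    D.Hom (Γ.map F.obj) (F.obj A) :=
  ⟨F.arr f.1, by rw [F.src, f.2.1], by rw [F.tgt, f.2.2]⟩

/-- The pointwise action on substitutions. -/
def sub (F : PreFunctor C D) {Γ Δ : List C.Obj} (γ : C.Sub Δ Γ) :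
    D.Sub (Δ.map F.obj) (Γ.map F.obj) :=
  Var.mapAll F.obj fun B x => F.hom (γ B x)

end PreFunctor

/-- A morphism of GTT categories: a CPM functor preserving the GTT structure.  Equations between
multiarrows are equations in the set of all multiarrows of `D`.  The greatest object, exponentials,
products and unit are preserved on the nose; local bottoms, being determined only up to
order-equivalence, are preserved in the sense that least elements go to least elements. -/
structure GttFunctor (C : GttCat.{u}) (D : GttCat.{w}) extends
    PreFunctor C.toPreMulti D.toPreMulti where
  obj_mono : ∀ A A', C.objLE A A' → D.objLE (obj A) (obj A')
  arr_mono : ∀ f f', C.arrLE f f' → D.arrLE (arr f) (arr f')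
  map_comp : ∀ {Γ Δ A} (f : C.Hom Γ A) (γ : C.Sub Δ Γ),
    arr (C.comp f γ).1 = (D.comp (toPreFunctor.hom f) (toPreFunctor.sub γ)).1
  map_proj : ∀ {Γ A} (x : Var Γ A), arr (C.proj x).1 = (D.proj (x.map obj)).1
  obj_top : obj C.top = D.top
  map_bot : ∀ {Γ A} (b : C.Hom Γ A), C.IsBot b → D.IsBot (toPreFunctor.hom b)
  obj_fn : ∀ A B, obj (C.fn A B) = D.fn (obj A) (obj B)
  map_lam : ∀ {Γ A B} (f : C.Hom (A :: Γ) B),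
    arr (C.lam f).1 = (D.lam (Γ := Γ.map obj) (toPreFunctor.hom f)).1
  map_app : ∀ A B, arr (C.app A B).1 = (D.app (obj A) (obj B)).1
  obj_prod : ∀ A B, obj (C.prod A B) = D.prod (obj A) (obj B)
  map_pair : ∀ {Γ A B} (f : C.Hom Γ A) (g : C.Hom Γ B),
    arr (C.pair f g).1 = (D.pair (toPreFunctor.hom f) (toPreFunctor.hom g)).1
  map_fst : ∀ A B, arr (C.fst A B).1 = (D.fst (obj A) (obj B)).1
  map_snd : ∀ A B, arr (C.snd A B).1 = (D.snd (obj A) (obj B)).1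
  obj_one : obj C.one = D.one
  map_unit : ∀ Γ, arr (C.unit Γ).1 = (D.unit (Γ.map obj)).1

/-! ## Interpretations -/

theorem GttCat.ty_le {S : PreSig.{u}} {C : GttCat.{w}} {b : S.Base → C.Obj}
    (hb : ∀ A A', S.tyAx A A' → C.objLE (C.ty b A) (C.ty b A')) {A A' : Ty S.Base}
    (h : S.TyDyn A A') : C.objLE (C.ty b A) (C.ty b A') := by
  induction h with
  | refl A => exact C.laws.obj_refl _
  | trans _ _ h₁ h₂ => exact C.laws.obj_trans _ _ _ h₁ h₂
  | ax h => exact hb _ _ h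
  | dynTop A => exact C.laws.le_top _
  | fnMon _ _ h₁ h₂ => exact C.laws.fn_mono _ _ _ _ h₁ h₂
  | prodMon _ _ h₁ h₂ => exact C.laws.prod_mono _ _ _ _ h₁ h₂

/-- A choice of upcasts, downcasts and local bottoms in a GTT category. -/
structure Choice (C : GttCat.{w}) where
  up {A A' : C.Obj} (h : C.objLE A A') : C.Hom [A] A'
  up_spec : ∀ {A A' : C.Obj} (h : C.objLE A A'), C.IsUpcast (up h)
  dn {A A' : C.Obj} (h : C.objLE A A') : C.Hom [A'] A
  dn_spec : ∀ {A A' : C.Obj} (h : C.objLE A A'), C.IsDowncast (dn h)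
  bot (Γ : List C.Obj) (A : C.Obj) : C.Hom Γ A
  bot_spec : ∀ (Γ : List C.Obj) (A : C.Obj), C.IsBot (bot Γ A)

/-- An interpretation of base types and function symbols in a GTT category that validates the type
dynamism axioms and respects the typing of function symbols. -/
structure PreInterp (S : PreSig.{u}) (C : GttCat.{w}) where
  base : S.Base → C.Obj
  tyAx : ∀ A A', S.tyAx A A' → C.objLE (C.ty base A) (C.ty base A')
  sym : S.Sym → C.Arr
  src : ∀ f, C.src (sym f) = (S.src f).map (C.ty base)
  tgt : ∀ f, C.tgt (sym f) = C.ty base (S.tgt f)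

namespace PreInterp

variable {S : PreSig.{u}} {C : GttCat.{w}}

/-- The interpretation of types. -/
def ty (I : PreInterp S C) : Ty S.Base → C.Obj := C.ty I.base

/-- The interpretation of a function symbol as an element of a hom-set. -/
def symHom (I : PreInterp S C) {Δ : S.Ctx} {A : Ty S.Base} (f : S.SymHom Δ A) :
    C.Hom (Δ.map I.ty) (I.ty A) :=
  ⟨I.sym f.1, by rw [I.src, f.2.1]; rfl, by rw [I.tgt, f.2.2]; rfl⟩

/-- The interpretation of terms, for a choice `k` of casts and local bottoms in `C`. -/
def tm (I : PreInterp S C) (k : Choice C) :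
    {Γ : S.Ctx} → {A : Ty S.Base} → S.Tm Γ A → C.Hom (Γ.map I.ty) (I.ty A)
  | _, _, .var x => C.proj (x.map I.ty)
  | _, _, .sym f args => C.comp (I.symHom f) (Var.mapAll I.ty fun B x => I.tm k (args B x))
  | _, _, .up h t => C.comp (k.up (GttCat.ty_le I.tyAx h)) (C.sub1 (I.tm k t))
  | _, _, .dn h t => C.comp (k.dn (GttCat.ty_le I.tyAx h)) (C.sub1 (I.tm k t))
  | Γ, _, .err A => k.bot (Γ.map I.ty) (I.ty A)
  | Γ, _, .lam t => C.lam (Γ := Γ.map I.ty) (I.tm k t)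
  | _, _, .ap t v => C.comp (C.app _ _) (C.sub2 (I.tm k v) (I.tm k t))
  | _, _, .pair t₁ t₂ => C.pair (I.tm k t₁) (I.tm k t₂)
  | _, _, .fst t => C.comp (C.fst _ _) (C.sub1 (I.tm k t))
  | _, _, .snd t => C.comp (C.snd _ _) (C.sub1 (I.tm k t))
  | Γ, _, .unit => C.unit (Γ.map I.ty)

end PreInterp

/-- An interpretation of a signature in a GTT category with a choice `k` of casts and local
bottoms: also the term dynamism axioms are validated. -/
structure Interp (S : GttSig.{u}) (C : GttCat.{w}) (k : Choice C) extends
    PreInterp S.toPreSig C where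
  tmAx : ∀ t t' : S.Tot, S.tmAx t t' →
    C.LE (toPreInterp.tm k t.2.2) (toPreInterp.tm k t'.2.2)

/-! ## The category of signatures -/

theorem Ty.map_id {B : Type u} (A : Ty B) : A.map id = A := by
  induction A <;> simp_all [Ty.map]

theorem Ty.map_map {B₁ B₂ B₃ : Type u} (i : B₁ → B₂) (j : B₂ → B₃) (A : Ty B₁) :
    (A.map i).map j = A.map (j ∘ i) := by
  induction A <;> simp_all [Ty.map]

/-- A translation of the first three layers of signatures. -/
@[ext] structure PreTrans (S T : PreSig.{u}) where
  base : S.Base → T.Base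
  sym : S.Sym → T.Sym
  tyAx : ∀ A A', S.tyAx A A' → T.tyAx (A.map base) (A'.map base)
  src : ∀ f, T.src (sym f) = (S.src f).map (Ty.map base)
  tgt : ∀ f, T.tgt (sym f) = (S.tgt f).map base

namespace PreTrans

variable {S T R : PreSig.{u}}

theorem tyDyn (i : PreTrans S T) {A A' : Ty S.Base} (h : S.TyDyn A A') :
    T.TyDyn (A.map i.base) (A'.map i.base) := by
  induction h with
  | refl A => exact .refl _
  | trans _ _ h₁ h₂ => exact .trans h₁ h₂
  | ax h => exact .ax (i.tyAx _ _ h)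
  | dynTop A => exact .dynTop _
  | fnMon _ _ h₁ h₂ => exact .fnMon h₁ h₂
  | prodMon _ _ h₁ h₂ => exact .prodMon h₁ h₂

/-- The translation of function symbols with given source and target. -/
def symHom (i : PreTrans S T) {Δ : S.Ctx} {A : Ty S.Base} (f : S.SymHom Δ A) :
    T.SymHom (Δ.map (Ty.map i.base)) (A.map i.base) :=
  ⟨i.sym f.1, by rw [i.src, f.2.1], by rw [i.tgt, f.2.2]⟩

/-- The translation of terms. -/
def tm (i : PreTrans S T) : {Γ : S.Ctx} → {A : Ty S.Base} → S.Tm Γ A →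
    T.Tm (Γ.map (Ty.map i.base)) (A.map i.base)
  | _, _, .var x => .var (x.map (Ty.map i.base))
  | _, _, .sym f args =>
      .sym (i.symHom f) (Var.mapAll (Ty.map i.base) fun B x => i.tm (args B x))
  | _, _, .up h t => .up (i.tyDyn h) (i.tm t)
  | _, _, .dn h t => .dn (i.tyDyn h) (i.tm t)
  | _, _, .err A => .err (A.map i.base)
  | _, _, .lam t => .lam (i.tm t)
  | _, _, .ap t v => .ap (i.tm t) (i.tm v)
  | _, _, .pair t₁ t₂ => .pair (i.tm t₁) (i.tm t₂)
  | _, _, .fst t => .fst (i.tm t)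
  | _, _, .snd t => .snd (i.tm t)
  | _, _, .unit => .unit

/-- The identity translation. -/
def ident (S : PreSig.{u}) : PreTrans S S where
  base := id
  sym := id
  tyAx A A' h := by rwa [Ty.map_id, Ty.map_id]
  src f := by rw [funext Ty.map_id]; simp
  tgt f := (Ty.map_id _).symm

/-- Composition of translations. -/
def comp (i : PreTrans S T) (j : PreTrans T R) : PreTrans S R where
  base := j.base ∘ i.base
  sym := j.sym ∘ i.sym
  tyAx A A' h := by
    rw [← Ty.map_map, ← Ty.map_map]
    exact j.tyAx _ _ (i.tyAx _ _ h)
  src f := by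
    simp [j.src, i.src, Ty.map_map]
  tgt f := by
    simp [j.tgt, i.tgt, Ty.map_map]

end PreTrans

/-! Functoriality of the translation of terms, needed for the category of signatures. -/

namespace Var

theorem cons_heq {O : Type u} {P : O → Type w} {Γ Γ' : List O} {A A' : O} (hΓ : Γ = Γ')
    (hA : A = A') {p : P A} {p' : P A'} (hp : HEq p p') {γ : ∀ B, Var Γ B → P B}
    {γ' : ∀ B, Var Γ' B → P B} (hγ : HEq γ γ') : HEq (cons p γ) (cons p' γ') := by
  subst hΓ hA
  cases hp
  cases hγ
  rfl

theorem mapAll_post {O O' : Type u} (F : O → O') {P Q : O' → Type w} (g : ∀ B, P B → Q B)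
    {Γ : List O} (a : ∀ A, Var Γ A → P (F A)) :
    (fun B x => g B (mapAll F a B x)) = mapAll F fun A x => g _ (a A x) := by
  induction Γ with
  | nil => funext B x; cases x
  | cons A Γ ih =>
    funext B x
    cases x with
    | z => rfl
    | s x => exact congrFun (congrFun (ih fun A x => a A (.s x)) B) x

theorem mapAll_ident {O : Type u} (F : O → O) (hF : F = id) {P P' : O → Type w} (hP : P = P')
    {Γ : List O} (a : ∀ A, Var Γ A → P (F A)) (a' : ∀ A, Var Γ A → P' A)
    (ha : ∀ A x, HEq (a A x) (a' A x)) : HEq (mapAll F a) a' := by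
  subst hF hP
  obtain rfl : a = a' := by funext A x; exact eq_of_heq (ha A x)
  induction Γ with
  | nil => exact heq_of_eq (by funext B x; cases x)
  | cons A Γ ih =>
    have h : a = cons (a A .z) fun B x => a B (.s x) := by
      funext B x; cases x <;> rfl
    conv_rhs => rw [h]
    exact cons_heq (List.map_id _) rfl HEq.rfl (ih _ fun _ _ => HEq.rfl)

theorem mapAll_comp {O O' O'' : Type u} (F : O → O') (G : O' → O'') (H : O → O'')
    (hH : H = G ∘ F) {P P' : O'' → Type w} (hP : P = P') {Γ : List O}
    (a : ∀ A, Var Γ A → P (H A)) (a' : ∀ A, Var Γ A → P' (G (F A)))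
    (ha : ∀ A x, HEq (a A x) (a' A x)) :
    HEq (mapAll H a) (mapAll G (mapAll F (P := fun B => P' (G B)) a')) := by
  subst hH hP
  obtain rfl : a = a' := by funext A x; exact eq_of_heq (ha A x)
  induction Γ with
  | nil => exact heq_of_eq (by funext B x; cases x)
  | cons A Γ ih =>
    exact cons_heq List.map_map.symm rfl HEq.rfl (ih _ fun _ _ => HEq.rfl)

end Var

namespace PreSig.Tm

variable {S : PreSig.{u}} {Γ Γ' Δ Δ' : S.Ctx} {A A' B B' : Ty S.Base}

theorem var_heq (hΓ : Γ = Γ') (hA : A = A') {x : Var Γ A} {x' : Var Γ' A'}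
    (hx : x.idx = x'.idx) : HEq (Tm.var x) (Tm.var x') := by
  subst hΓ hA
  have key : ∀ {Γ : S.Ctx} {A} (x y : Var Γ A), x.idx = y.idx → x = y := by
    intro Γ A x
    induction x with
    | z => intro y h; cases y with
      | z => rfl
      | s y => simp [Var.idx] at h
    | s x ih => intro y h; cases y with
      | z => simp [Var.idx] at h
      | s y => rw [ih y (by simpa [Var.idx] using h)]
  rw [key _ _ hx]

theorem sym_heq (hΓ : Γ = Γ') (hΔ : Δ = Δ') (hA : A = A') {f : S.SymHom Δ A}
    {f' : S.SymHom Δ' A'} (hf : f.1 = f'.1) {a : ∀ B, Var Δ B → S.Tm Γ B}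
    {a' : ∀ B, Var Δ' B → S.Tm Γ' B} (ha : HEq a a') : HEq (Tm.sym f a) (Tm.sym f' a') := by
  subst hΓ hΔ hA
  obtain rfl := Subtype.ext hf
  cases ha
  rfl

theorem up_heq (hΓ : Γ = Γ') (hA : A = A') (hB : B = B') (h : S.TyDyn A B) (h' : S.TyDyn A' B')
    {t : S.Tm Γ A} {t' : S.Tm Γ' A'} (ht : HEq t t') : HEq (Tm.up h t) (Tm.up h' t') := by
  subst hΓ hA hB; cases ht; rfl

theorem dn_heq (hΓ : Γ = Γ') (hA : A = A') (hB : B = B') (h : S.TyDyn A B) (h' : S.TyDyn A' B')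
    {t : S.Tm Γ B} {t' : S.Tm Γ' B'} (ht : HEq t t') : HEq (Tm.dn h t) (Tm.dn h' t') := by
  subst hΓ hA hB; cases ht; rfl

theorem err_heq (hΓ : Γ = Γ') (hA : A = A') :
    HEq (Tm.err A : S.Tm Γ A) (Tm.err A' : S.Tm Γ' A') := by
  subst hΓ hA; rfl

theorem lam_heq (hΓ : Γ = Γ') (hA : A = A') (hB : B = B') {t : S.Tm (A :: Γ) B}
    {t' : S.Tm (A' :: Γ') B'} (ht : HEq t t') : HEq (Tm.lam t) (Tm.lam t') := by
  subst hΓ hA hB; cases ht; rfl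

theorem ap_heq (hΓ : Γ = Γ') (hA : A = A') (hB : B = B') {t : S.Tm Γ (.fn A B)}
    {t' : S.Tm Γ' (.fn A' B')} (ht : HEq t t') {v : S.Tm Γ A} {v' : S.Tm Γ' A'} (hv : HEq v v') :
    HEq (Tm.ap t v) (Tm.ap t' v') := by
  subst hΓ hA hB; cases ht; cases hv; rfl

theorem pair_heq (hΓ : Γ = Γ') (hA : A = A') (hB : B = B') {t : S.Tm Γ A}
    {t' : S.Tm Γ' A'} (ht : HEq t t') {v : S.Tm Γ B} {v' : S.Tm Γ' B'} (hv : HEq v v') :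
    HEq (Tm.pair t v) (Tm.pair t' v') := by
  subst hΓ hA hB; cases ht; cases hv; rfl

theorem fst_heq (hΓ : Γ = Γ') (hA : A = A') (hB : B = B') {t : S.Tm Γ (.prod A B)}
    {t' : S.Tm Γ' (.prod A' B')} (ht : HEq t t') : HEq (Tm.fst t) (Tm.fst t') := by
  subst hΓ hA hB; cases ht; rfl

theorem snd_heq (hΓ : Γ = Γ') (hA : A = A') (hB : B = B') {t : S.Tm Γ (.prod A B)}
    {t' : S.Tm Γ' (.prod A' B')} (ht : HEq t t') : HEq (Tm.snd t) (Tm.snd t') := by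
  subst hΓ hA hB; cases ht; rfl

theorem unit_heq (hΓ : Γ = Γ') : HEq (Tm.unit : S.Tm Γ _) (Tm.unit : S.Tm Γ' _) := by
  subst hΓ; rfl

theorem tot_congr (hΓ : Γ = Γ') (hA : A = A') {t : S.Tm Γ A} {t' : S.Tm Γ' A'}
    (ht : HEq t t') : t.tot = t'.tot := by
  subst hΓ hA; cases ht; rfl

end PreSig.Tm

theorem Var.idx_map {O : Type u} {O' : Type w} (F : O → O') {Γ : List O} {A : O} (x : Var Γ A) :
    (x.map F).idx = x.idx := by
  induction x with
  | z => rfl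
  | s x ih => simp [Var.map, Var.idx, ih]

namespace PreTrans

variable {S T R : PreSig.{u}}

/-- The translation of terms on the set of all terms. -/
def tot (i : PreTrans S T) (t : S.Tot) : T.Tot := (i.tm t.2.2).tot

theorem tm_ident {Γ : S.Ctx} {A : Ty S.Base} (t : S.Tm Γ A) : HEq ((ident S).tm t) t := by
  have hm : Ty.map (ident S).base = id := funext Ty.map_id
  have hc : ∀ Γ : S.Ctx, Γ.map (Ty.map (ident S).base) = Γ := fun Γ => by rw [hm, List.map_id]
  have ha : ∀ A, Ty.map (ident S).base A = A := Ty.map_id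
  induction t with
  | var x => exact PreSig.Tm.var_heq (hc _) (ha _) (x.idx_map _)
  | @sym Γ Δ A f args ih =>
    exact PreSig.Tm.sym_heq (hc _) (hc _) (ha _) rfl
      (Var.mapAll_ident _ hm (by rw [hc]) _ _ fun A x => ih A x)
  | up h t ih => exact PreSig.Tm.up_heq (hc _) (ha _) (ha _) _ _ ih
  | dn h t ih => exact PreSig.Tm.dn_heq (hc _) (ha _) (ha _) _ _ ih
  | err A => exact PreSig.Tm.err_heq (hc _) (ha _)
  | lam t ih => exact PreSig.Tm.lam_heq (hc _) (ha _) (ha _) ih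
  | ap t v ih₁ ih₂ => exact PreSig.Tm.ap_heq (hc _) (ha _) (ha _) ih₁ ih₂
  | pair t v ih₁ ih₂ => exact PreSig.Tm.pair_heq (hc _) (ha _) (ha _) ih₁ ih₂
  | fst t ih => exact PreSig.Tm.fst_heq (hc _) (ha _) (ha _) ih
  | snd t ih => exact PreSig.Tm.snd_heq (hc _) (ha _) (ha _) ih
  | unit => exact PreSig.Tm.unit_heq (hc _)

theorem tm_comp (i : PreTrans S T) (j : PreTrans T R) {Γ : S.Ctx} {A : Ty S.Base}
    (t : S.Tm Γ A) : HEq ((i.comp j).tm t) (j.tm (i.tm t)) := by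
  have hm : Ty.map (i.comp j).base = Ty.map j.base ∘ Ty.map i.base :=
    funext fun A => (Ty.map_map i.base j.base A).symm
  have hc : ∀ Γ : S.Ctx, Γ.map (Ty.map (i.comp j).base) =
      (Γ.map (Ty.map i.base)).map (Ty.map j.base) := fun Γ => by rw [hm, List.map_map]
  have ha : ∀ A, Ty.map (i.comp j).base A = (A.map i.base).map j.base := fun A =>
    congrFun hm A
  induction t with
  | var x => exact PreSig.Tm.var_heq (hc _) (ha _) (by simp [Var.idx_map])
  | @sym Γ Δ A f args ih =>
    refine PreSig.Tm.sym_heq (hc _) (hc _) (ha _) rfl ?_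
    rw [Var.mapAll_post (P := fun B => T.Tm (Γ.map (Ty.map i.base)) B)
      (Q := fun B => R.Tm ((Γ.map (Ty.map i.base)).map (Ty.map j.base)) (B.map j.base))
      (Ty.map i.base) (fun B t => j.tm t)]
    exact Var.mapAll_comp (Ty.map i.base) (Ty.map j.base) _ hm
      (P' := fun B => R.Tm ((Γ.map (Ty.map i.base)).map (Ty.map j.base)) B)
      (by rw [hc]) _ _ fun A x => ih A x
  | up h t ih => exact PreSig.Tm.up_heq (hc _) (ha _) (ha _) _ _ ih
  | dn h t ih => exact PreSig.Tm.dn_heq (hc _) (ha _) (ha _) _ _ ih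
  | err A => exact PreSig.Tm.err_heq (hc _) (ha _)
  | lam t ih => exact PreSig.Tm.lam_heq (hc _) (ha _) (ha _) ih
  | ap t v ih₁ ih₂ => exact PreSig.Tm.ap_heq (hc _) (ha _) (ha _) ih₁ ih₂
  | pair t v ih₁ ih₂ => exact PreSig.Tm.pair_heq (hc _) (ha _) (ha _) ih₁ ih₂
  | fst t ih => exact PreSig.Tm.fst_heq (hc _) (ha _) (ha _) ih
  | snd t ih => exact PreSig.Tm.snd_heq (hc _) (ha _) (ha _) ih
  | unit => exact PreSig.Tm.unit_heq (hc _)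

theorem tot_ident (t : S.Tot) : (ident S).tot t = t :=
  PreSig.Tm.tot_congr (by show List.map (Ty.map id) _ = _; rw [funext Ty.map_id]; simp)
    (Ty.map_id _) (tm_ident t.2.2)

theorem tot_comp (i : PreTrans S T) (j : PreTrans T R) (t : S.Tot) :
    (i.comp j).tot t = j.tot (i.tot t) :=
  PreSig.Tm.tot_congr (by
      show t.1.map (Ty.map (i.comp j).base) = (t.1.map (Ty.map i.base)).map (Ty.map j.base)
      rw [List.map_map]
      exact congrFun (congrArg List.map (funext fun A => (Ty.map_map i.base j.base A).symm)) t.1)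
    (Ty.map_map i.base j.base t.2.1).symm (tm_comp i j t.2.2)

end PreTrans

/-- A translation of GTT signatures: base types go to base types, function symbols to function
symbols of the translated type, and dynamism axioms to dynamism axioms. -/
@[ext] structure Translation (S T : GttSig.{u}) extends PreTrans S.toPreSig T.toPreSig where
  tmAx : ∀ t t', S.tmAx t t' → T.tmAx (toPreTrans.tot t) (toPreTrans.tot t')

/-- The category of GTT signatures and translations. -/
instance : Category GttSig.{u} where
  Hom S T := Translation S T
  id S := { PreTrans.ident S.toPreSig with
    tmAx := fun t t' h => by
      have e := PreTrans.tot_ident (S := S.toPreSig)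
      exact (e t).symm ▸ (e t').symm ▸ h }
  comp i j := { i.toPreTrans.comp j.toPreTrans with
    tmAx := fun t t' h => by
      have e := PreTrans.tot_comp i.toPreTrans j.toPreTrans
      exact (e t).symm ▸ (e t').symm ▸ j.tmAx _ _ (i.tmAx _ _ h) }

/-! ## The category of GTT categories -/

namespace PreFunctor

theorem mapAll_heq {C : PreMulti.{u}} {O : Type w} {Δ Δ' : List C.Obj} (hΔ : Δ = Δ')
    {F G : O → C.Obj} (hF : F = G) {Γ : List O} {a : ∀ A, Var Γ A → C.Hom Δ (F A)}
    {b : ∀ A, Var Γ A → C.Hom Δ' (G A)} (h : ∀ A x, (a A x).1 = (b A x).1) :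
    HEq (Var.mapAll F (P := C.Hom Δ) a) (Var.mapAll G (P := C.Hom Δ') b) := by
  subst hΔ hF
  obtain rfl : a = b := by funext A x; exact Subtype.ext (h A x)
  rfl

theorem hom_heq {C : PreMulti.{u}} {Γ Γ' : List C.Obj} {A A' : C.Obj} (hΓ : Γ = Γ')
    (hA : A = A') {f : C.Hom Γ A} {g : C.Hom Γ' A'} (h : f.1 = g.1) : HEq f g := by
  subst hΓ hA; exact heq_of_eq (Subtype.ext h)

theorem comp_val {C : MultiData.{u}} {Γ Γ' Δ Δ' : List C.Obj} {A A' : C.Obj} (hΓ : Γ = Γ')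
    (hΔ : Δ = Δ') (hA : A = A') {f : C.Hom Γ A} {g : C.Hom Γ' A'} (h : f.1 = g.1)
    {γ : C.Sub Δ Γ} {δ : C.Sub Δ' Γ'} (hγ : HEq γ δ) : (C.comp f γ).1 = (C.comp g δ).1 := by
  subst hΓ hΔ hA; obtain rfl := Subtype.ext h; cases hγ; rfl

theorem proj_val {C : MultiData.{u}} {Γ Γ' : List C.Obj} {A A' : C.Obj} (hΓ : Γ = Γ')
    (hA : A = A') {x : Var Γ A} {y : Var Γ' A'} (h : HEq x y) :
    (C.proj x).1 = (C.proj y).1 := by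
  subst hΓ hA; cases h; rfl

theorem lam_val {C : GttData.{u}} {Γ Γ' : List C.Obj} {A A' B B' : C.Obj} (hΓ : Γ = Γ')
    (hA : A = A') (hB : B = B') {f : C.Hom (A :: Γ) B} {g : C.Hom (A' :: Γ') B'}
    (h : f.1 = g.1) : (C.lam f).1 = (C.lam g).1 := by
  subst hΓ hA hB; obtain rfl := Subtype.ext h; rfl

theorem pair_val {C : GttData.{u}} {Γ Γ' : List C.Obj} {A A' B B' : C.Obj} (hΓ : Γ = Γ')
    (hA : A = A') (hB : B = B') {f : C.Hom Γ A} {f' : C.Hom Γ' A'} (hf : f.1 = f'.1)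
    {g : C.Hom Γ B} {g' : C.Hom Γ' B'} (hg : g.1 = g'.1) :
    (C.pair f g).1 = (C.pair f' g').1 := by
  subst hΓ hA hB; obtain rfl := Subtype.ext hf; obtain rfl := Subtype.ext hg; rfl

theorem isBot_of_val {C : PreMulti.{u}} {Γ Γ' : List C.Obj} {A A' : C.Obj} (hΓ : Γ = Γ')
    (hA : A = A') {f : C.Hom Γ A} {g : C.Hom Γ' A'} (h : f.1 = g.1) (hf : C.IsBot f) :
    C.IsBot g := by
  subst hΓ hA; obtain rfl := Subtype.ext h; exact hf

end PreFunctor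

theorem Var.map_heq {O : Type u} {O' : Type w} {F G : O → O'} (h : F = G) {Γ : List O} {A : O}
    (x : Var Γ A) : HEq (x.map F) (x.map G) := by
  subst h; rfl

theorem Var.z_heq {O : Type u} {Γ Γ' : List O} {A A' : O} (hΓ : Γ = Γ') (hA : A = A') :
    HEq (Var.z : Var (A :: Γ) A) (Var.z : Var (A' :: Γ') A') := by
  subst hΓ hA; rfl

theorem Var.s_heq {O : Type u} {Γ Γ' : List O} {A A' B B' : O} (hΓ : Γ = Γ') (hA : A = A')
    (hB : B = B') {x : Var Γ A} {y : Var Γ' A'} (h : HEq x y) :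
    HEq (Var.s x : Var (B :: Γ) A) (Var.s y : Var (B' :: Γ') A') := by
  subst hΓ hA hB; cases h; rfl

theorem Var.map_ident {O : Type u} {Γ : List O} {A : O} (x : Var Γ A) : HEq (x.map id) x := by
  induction x with
  | @z Γ A => exact Var.z_heq (List.map_id _) rfl
  | s x ih => exact Var.s_heq (List.map_id _) rfl rfl ih

theorem Var.map_comp {O₁ O₂ O₃ : Type u} (F : O₁ → O₂) (G : O₂ → O₃) {Γ : List O₁} {A : O₁}
    (x : Var Γ A) : HEq (x.map (G ∘ F)) ((x.map F).map G) := by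
  induction x with
  | @z Γ A => exact Var.z_heq List.map_map.symm rfl
  | s x ih => exact Var.s_heq List.map_map.symm rfl rfl ih

namespace GttFunctor

/-- The identity functor. -/
def ident (C : GttCat.{u}) : GttFunctor C C where
  obj := id
  arr := id
  src f := (List.map_id _).symm
  tgt f := rfl
  obj_mono _ _ h := h
  arr_mono _ _ h := h
  map_comp f γ := PreFunctor.comp_val (List.map_id _).symm (List.map_id _).symm rfl rfl
    (Var.mapAll_ident id rfl (by rw [List.map_id]; rfl) _ _
      fun A x => PreFunctor.hom_heq (List.map_id _) rfl rfl).symm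
  map_proj x := PreFunctor.proj_val (List.map_id _).symm rfl (Var.map_ident x).symm
  obj_top := rfl
  map_bot b h := PreFunctor.isBot_of_val (List.map_id _).symm rfl (by rfl) h
  obj_fn _ _ := rfl
  map_lam f := PreFunctor.lam_val (List.map_id _).symm rfl rfl (by rfl)
  map_app _ _ := rfl
  obj_prod _ _ := rfl
  map_pair f g := PreFunctor.pair_val (List.map_id _).symm rfl rfl (by rfl) (by rfl)
  map_fst _ _ := rfl
  map_snd _ _ := rfl
  obj_one := rfl
  map_unit Γ := by rw [List.map_id]; rfl

/-- Composition of functors. -/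
def comp {C D E : GttCat.{u}} (F : GttFunctor C D) (G : GttFunctor D E) : GttFunctor C E where
  obj := G.obj ∘ F.obj
  arr := G.arr ∘ F.arr
  src f := by simp [G.src, F.src]
  tgt f := by simp [G.tgt, F.tgt]
  obj_mono _ _ h := G.obj_mono _ _ (F.obj_mono _ _ h)
  arr_mono _ _ h := G.arr_mono _ _ (F.arr_mono _ _ h)
  map_comp f γ := by
    simp only [Function.comp_apply]
    rw [F.map_comp, G.map_comp]
    refine PreFunctor.comp_val List.map_map List.map_map rfl rfl ?_
    unfold PreFunctor.sub
    rw [Var.mapAll_post (Q := fun B => E.Hom _ (G.obj B)) F.obj (fun B f => G.hom f)]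
    exact (Var.mapAll_comp F.obj G.obj _ rfl (by rw [List.map_map]) _ _
      fun A x => PreFunctor.hom_heq List.map_map.symm rfl rfl).symm
  map_proj x := by
    simp only [Function.comp_apply]
    rw [F.map_proj, G.map_proj]
    exact PreFunctor.proj_val List.map_map rfl (Var.map_comp _ _ x).symm
  obj_top := by simp [F.obj_top, G.obj_top]
  map_bot b h :=
    PreFunctor.isBot_of_val List.map_map rfl (f := G.hom (F.hom b)) (by rfl)
      (G.map_bot _ (F.map_bot b h))
  obj_fn _ _ := by simp [F.obj_fn, G.obj_fn]
  map_lam f := by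
    simp only [Function.comp_apply]
    rw [F.map_lam, G.map_lam]
    exact PreFunctor.lam_val List.map_map rfl rfl (by rfl)
  map_app _ _ := by simp [F.map_app, G.map_app]
  obj_prod _ _ := by simp [F.obj_prod, G.obj_prod]
  map_pair f g := by
    simp only [Function.comp_apply]
    rw [F.map_pair, G.map_pair]
    exact PreFunctor.pair_val List.map_map rfl rfl (by rfl) (by rfl)
  map_fst _ _ := by simp [F.map_fst, G.map_fst]
  map_snd _ _ := by simp [F.map_snd, G.map_snd]
  obj_one := by simp [F.obj_one, G.obj_one]
  map_unit Γ := by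
    simp only [Function.comp_apply]
    rw [F.map_unit, G.map_unit, List.map_map]

end GttFunctor

/-- The category of GTT categories. -/
instance : Category GttCat.{u} where
  Hom C D := GttFunctor C D
  id C := GttFunctor.ident C
  comp F G := F.comp G
  id_comp _ := rfl
  comp_id _ := rfl
  assoc _ _ _ := rfl

/-- Equality of functors up to order-equivalence on multiarrows. -/
def GttFunctor.Equiv {C : GttCat.{u}} {D : GttCat.{w}} (F G : GttFunctor C D) : Prop :=
  F.obj = G.obj ∧ ∀ f, D.ArrEquiv (F.arr f) (G.arr f)

/-! ## The complete signature of a GTT category -/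

/-- A function symbol of the complete signature: a multiarrow of `C` together with a list of types
and a type over the objects of `C` that denote its source and target. -/
@[ext] structure FormalArr (C : GttCat.{u}) : Type u where
  ctx : List (Ty C.Obj)
  ty : Ty C.Obj
  arr : C.Arr
  src : C.src arr = ctx.map (C.ty id)
  tgt : C.tgt arr = C.ty id ty

/-- The first three layers of the complete signature: all objects as base types, all true
orderings of denoted objects as type dynamism axioms, all multiarrows as function symbols. -/
abbrev completePreSig (C : GttCat.{u}) : PreSig.{u} where
  Base := C.Obj
  tyAx A A' := C.objLE (C.ty id A) (C.ty id A')
  Sym := FormalArr C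
  src f := f.ctx
  tgt f := f.ty

/-- The tautological interpretation of the complete signature. -/
def completeInterp (C : GttCat.{u}) : PreInterp (completePreSig C) C where
  base := id
  tyAx _ _ h := h
  sym f := f.arr
  src f := f.src
  tgt f := f.tgt

/-- The complete signature `U C` of a GTT category: its term dynamism axioms are all pairs of
terms whose contexts and types are related and whose denotations in `C` are ordered (for every
choice of casts and local bottoms; all choices are order-equivalent). -/
abbrev completeSig (C : GttCat.{u}) : GttSig.{u} where
  toPreSig := completePreSig C
  tmAx t t' := (completePreSig C).CtxDyn t.1 t'.1 ∧ (completePreSig C).TyDyn t.2.1 t'.2.1 ∧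
    ∀ k : Choice C, C.LE ((completeInterp C).tm k t.2.2) ((completeInterp C).tm k t'.2.2)
  tmAx_ctx _ _ h := h.1
  tmAx_ty _ _ h := h.2.1

theorem GttCat.ty_map {B B' : Type u} (C : GttCat.{w}) (i : B → B') (b : B' → C.Obj) (A : Ty B) :
    C.ty b (A.map i) = C.ty (b ∘ i) A := by
  induction A <;> simp_all [Ty.map, GttData.ty]

/-- The interpretation of `S` in `C` given by a translation from `S` to the complete signature. -/
def Translation.toPreInterp {S : GttSig.{u}} {C : GttCat.{u}} (i : Translation S (completeSig C)) :
    PreInterp S.toPreSig C where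
  base := i.base
  tyAx A A' h := by
    have h' : C.objLE (C.ty id (A.map i.base)) (C.ty id (A'.map i.base)) := i.tyAx A A' h
    rwa [C.ty_map, C.ty_map] at h'
  sym f := (i.sym f : FormalArr C).arr
  src f := by
    have h : (i.sym f : FormalArr C).ctx = (S.src f).map (Ty.map i.base) := i.src f
    rw [FormalArr.src (i.sym f : FormalArr C), h, List.map_map]
    exact congrFun (congrArg List.map (funext fun A => C.ty_map i.base id A)) _
  tgt f := by
    have h : (i.sym f : FormalArr C).ty = (S.tgt f).map i.base := i.tgt f
    rw [FormalArr.tgt (i.sym f : FormalArr C), h]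
    exact C.ty_map i.base id _

/-- Equality of translations up to order-equivalence of the multiarrows that function symbols
are sent to. -/
def Translation.Equiv {S : GttSig.{u}} {C : GttCat.{u}} (i j : Translation S (completeSig C)) :
    Prop :=
  i.base = j.base ∧
    ∀ f, C.ArrEquiv (i.sym f : FormalArr C).arr (j.sym f : FormalArr C).arr

/-! ## The syntactic GTT category -/

section Syn

variable (S : GttSig.{u})

/-- The set of terms `Γ ⊢ t : A` modulo `βη`-equality. -/
def TmQ (Γ : S.Ctx) (A : Ty S.Base) : Type u := Quot (S.TmEq (Γ := Γ) (A := A))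

/-- Types and terms modulo `βη`-equality, ordered by derivability of dynamism. -/
abbrev synMulti : PreMulti.{u} where
  Obj := Ty S.Base
  Arr := Σ (Γ : S.Ctx) (A : Ty S.Base), TmQ S Γ A
  objLE := S.TyDyn
  arrLE f g := ∃ (t : S.Tm f.1 f.2.1) (t' : S.Tm g.1 g.2.1),
    Quot.mk _ t = f.2.2 ∧ Quot.mk _ t' = g.2.2 ∧ S.TmDyn t t'
  src f := f.1
  tgt f := f.2.1

variable {S}

/-- A class of terms as a multiarrow. -/
def TmQ.hom {Γ : S.Ctx} {A : Ty S.Base} (q : TmQ S Γ A) : (synMulti S).Hom Γ A :=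
  ⟨⟨Γ, A, q⟩, rfl, rfl⟩

/-- A multiarrow as a class of terms. -/
def TmQ.ofHom : {Γ : S.Ctx} → {A : Ty S.Base} → (synMulti S).Hom Γ A → TmQ S Γ A
  | _, _, ⟨⟨_, _, q⟩, rfl, rfl⟩ => q

/-- A representative of a multiarrow. -/
noncomputable def repr {Γ : S.Ctx} {A : Ty S.Base} (f : (synMulti S).Hom Γ A) : S.Tm Γ A :=
  Quot.out (TmQ.ofHom f)

/-- The multiarrow represented by a term. -/
def cls {Γ : S.Ctx} {A : Ty S.Base} (t : S.Tm Γ A) : (synMulti S).Hom Γ A :=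
  TmQ.hom (Quot.mk _ t)

variable (S)

/-- The structure of the syntactic GTT category: composition is substitution, projections are
variables, and the remaining operations are the term formers.  The operations respect
`βη`-equality, so they do not depend on the representatives. -/
noncomputable abbrev synData : GttData.{u} where
  toPreMulti := synMulti S
  proj x := cls (.var x)
  comp f γ := cls ((repr f).subst fun B x => repr (γ B x))
  top := .dyn
  fn := .fn
  lam f := cls (.lam (repr f))
  app _ _ := cls (.ap (.var (.s .z)) (.var .z))
  prod := .prod
  pair f g := cls (.pair (repr f) (repr g))
  fst _ _ := cls (.fst (.var .z))
  snd _ _ := cls (.snd (.var .z))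
  one := .one
  unit _ := cls .unit

end Syn

/-- The action of a morphism of signatures on base types, function symbols and terms. -/
abbrev sigMap {S T : GttSig.{u}} (i : S ⟶ T) : PreTrans S.toPreSig T.toPreSig :=
  Translation.toPreTrans i

/-- The action of a morphism of GTT categories on objects and multiarrows. -/
abbrev catMap {C D : GttCat.{u}} (F : C ⟶ D) : PreFunctor C.toPreMulti D.toPreMulti :=
  GttFunctor.toPreFunctor F

/-- The multiarrow that a translation into a complete signature assigns to a function symbol. -/
abbrev symArr {S : GttSig.{u}} {C : GttCat.{u}} (i : S ⟶ completeSig C) (f : S.Sym) : C.Arr :=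
  FormalArr.arr ((sigMap i).sym f)

/-- The syntactic GTT category of `S`, given that the laws hold for the syntax. -/
noncomputable abbrev synCat (h : ∀ S : GttSig.{u}, (synData S).IsGttCat) (S : GttSig.{u}) :
    GttCat.{u} where
  toGttData := synData S
  laws := h S

/-- The term `f(x₀, …)`: a function symbol applied to the variables. -/
def symTm {S : GttSig.{u}} (f : S.Sym) : S.Tm (S.src f) (S.tgt f) :=
  .sym ⟨f, rfl, rfl⟩ fun _ x => .var x

end GTT

open GTT

-- The terms of `S` modulo βη form the free GTT category on `S`, except that casts and errors are
-- determined only up to order-equivalence. Everything rests on two facts about denotations.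
--
-- Substitution denotes composition. As an equation this can fail at errors: `b ∘ γ` is least when
-- `b` is, but need not be the chosen least element. Bottoms can however be chosen in the empty
-- context and weakened, which makes the choice stable under composition (`exists_stable_choice`).
-- For a stable choice `PreInterp.tm_subst` is an equality, so βη-equal terms have equal denotations
-- (`PreInterp.tm_tmEq`), and soundness follows by induction on derivations
-- (`Interp.tm_le_of_stable`).
--
-- Morphisms carry denotations to denotations up to order-equivalence (`GttFunctor.tm_equiv`).
-- Upcasts and downcasts are characterised by inequalities with identities, hence are preserved by
-- every morphism and unique up to order-equivalence; least elements behave likewise. For the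
-- identity morphism this says that the choice of casts and bottoms is immaterial, which extends
-- soundness to all choices.
--
-- For completeness, the syntax is itself a GTT category (`synLaws`). Its order on classes of terms
-- is exactly derivability (`le_cls_iff`), because βη-equality is contained in term dynamism in both
-- directions. In the tautological interpretation each term denotes its own class
-- (`synPreInterp_tm`), so validity there is derivability.
--
-- For initiality, a stable denotation descends to βη-classes and gives a morphism
-- (`Interp.functor`). Another morphism that agrees on generators is compared with it by applying
-- `GttFunctor.tm_equiv` to the tautological interpretation. The actions on signatures and the unit
-- rest on `PreInterp.precomp_tm`: interpreting a translated term is interpreting the term along the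
-- composite.

universe v

namespace GTT

/-! ### Substitution calculus of terms -/

namespace Var

theorem cons_congr {O : Type u} {P : O → Type w} {Γ : List O} {A : O}
    {γ δ : ∀ B, Var (A :: Γ) B → P B} (hz : γ A .z = δ A .z)
    (hs : ∀ B x, γ B (.s x) = δ B (.s x)) : γ = δ := by
  funext B x
  cases x with
  | z => exact hz
  | s x => exact hs B x

end Var

namespace PreSig

variable {S : PreSig.{u}}

namespace Tm

theorem rename_congr {Γ Δ : S.Ctx} {A : Ty S.Base} (t : S.Tm Γ A)
    {ρ σ : ∀ B, Var Γ B → Var Δ B} (h : ρ = σ) : t.rename ρ = t.rename σ := by rw [h]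

theorem subst_congr {Γ Δ : S.Ctx} {A : Ty S.Base} (t : S.Tm Γ A)
    {γ δ : ∀ B, Var Γ B → S.Tm Δ B} (h : γ = δ) : t.subst γ = t.subst δ := by rw [h]

theorem rename_rename {Γ Δ Θ : S.Ctx} {A : Ty S.Base} (t : S.Tm Γ A)
    (ρ : ∀ B, Var Γ B → Var Δ B) (σ : ∀ B, Var Δ B → Var Θ B) :
    (t.rename ρ).rename σ = t.rename fun B x => σ B (ρ B x) := by
  induction t generalizing Δ Θ with
  | lam t ih =>
    simp only [rename, ih]
    refine congrArg _ (rename_congr _ (Var.cons_congr rfl fun _ _ => rfl))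
  | _ => simp only [rename, *]

theorem rename_eq_subst {Γ Δ : S.Ctx} {A : Ty S.Base} (t : S.Tm Γ A)
    (ρ : ∀ B, Var Γ B → Var Δ B) : t.rename ρ = t.subst fun B x => .var (ρ B x) := by
  induction t generalizing Δ with
  | lam t ih =>
    simp only [rename, subst, ih]
    refine congrArg _ (subst_congr _ (Var.cons_congr rfl fun _ _ => rfl))
  | _ => simp only [rename, subst, *]

theorem rename_subst {Γ Δ Θ : S.Ctx} {A : Ty S.Base} (t : S.Tm Γ A)
    (ρ : ∀ B, Var Γ B → Var Δ B) (γ : ∀ B, Var Δ B → S.Tm Θ B) :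
    (t.rename ρ).subst γ = t.subst fun B x => γ B (ρ B x) := by
  induction t generalizing Δ Θ with
  | lam t ih =>
    simp only [rename, subst, ih]
    refine congrArg _ (subst_congr _ (Var.cons_congr rfl fun _ _ => rfl))
  | _ => simp only [rename, subst, *]

theorem subst_rename {Γ Δ Θ : S.Ctx} {A : Ty S.Base} (t : S.Tm Γ A)
    (γ : ∀ B, Var Γ B → S.Tm Δ B) (ρ : ∀ B, Var Δ B → Var Θ B) :
    (t.subst γ).rename ρ = t.subst fun B x => (γ B x).rename ρ := by
  induction t generalizing Δ Θ with
  | lam t ih =>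
    simp only [rename, subst, ih]
    refine congrArg _ (subst_congr _ (Var.cons_congr rfl fun B x => ?_))
    simp only [Var.cons, wk, rename_rename]
  | _ => simp only [rename, subst, *]

/-- Under a binder the substituted terms are weakened, and weakening is a renaming. The binder case
therefore needs the two mixed laws `rename_subst` and `subst_rename`, the latter resting on
`rename_rename`. -/
theorem subst_subst {Γ Δ Θ : S.Ctx} {A : Ty S.Base} (t : S.Tm Γ A)
    (γ : ∀ B, Var Γ B → S.Tm Δ B) (δ : ∀ B, Var Δ B → S.Tm Θ B) :
    (t.subst γ).subst δ = t.subst fun B x => (γ B x).subst δ := by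
  induction t generalizing Δ Θ with
  | lam t ih =>
    simp only [subst, ih]
    refine congrArg _ (subst_congr _ (Var.cons_congr rfl fun B x => ?_))
    simp only [Var.cons, wk, rename_subst, subst_rename]
  | _ => simp only [subst, *]

theorem subst_var {Γ : S.Ctx} {A : Ty S.Base} (t : S.Tm Γ A) :
    (t.subst fun _ x => .var x) = t := by
  induction t with
  | lam t ih =>
    simp only [subst]
    refine congrArg _ (Eq.trans (subst_congr _ (δ := fun _ x => .var x)
      (Var.cons_congr rfl fun _ _ => rfl)) ih)
  | _ => simp only [subst, *]

theorem wk_subst_cons {Γ Δ : S.Ctx} {A B : Ty S.Base} (t : S.Tm Γ A) (v : S.Tm Δ B)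
    (γ : ∀ B, Var Γ B → S.Tm Δ B) : t.wk.subst (Var.cons v γ) = t.subst γ :=
  rename_subst _ _ _

theorem wk_subst_lift {Γ Δ : S.Ctx} {A B : Ty S.Base} (t : S.Tm Γ A)
    (γ : ∀ B, Var Γ B → S.Tm Δ B) :
    t.wk.subst (Var.cons (.var .z) fun B x => (γ B x).wk) = (t.subst γ).wk (B := B) := by
  rw [wk_subst_cons, wk, subst_rename]; rfl

/-- Stability of β-reduction under substitution comes from this. Both sides put `v.subst γ` for the
bound variable and `γ` for the others, since weakening followed by instantiation cancels. -/
theorem inst_subst {Γ Δ : S.Ctx} {A B : Ty S.Base} (t : S.Tm (A :: Γ) B) (v : S.Tm Γ A)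
    (γ : ∀ B, Var Γ B → S.Tm Δ B) :
    (t.inst v).subst γ =
      (t.subst (Var.cons (.var .z) fun B x => (γ B x).wk)).inst (v.subst γ) := by
  rw [inst, inst, subst_subst, subst_subst]
  refine subst_congr _ (Var.cons_congr rfl fun B x => ?_)
  simp only [Var.cons, wk_subst_cons, subst_var, subst]

/-- The left side is the contractum of the weakened abstraction applied to the new variable, as it
arises in the law `unlam_lam` of the syntax. -/
theorem rename_inst_z {Γ : S.Ctx} {A B : Ty S.Base} (t : S.Tm (A :: Γ) B) :
    (t.rename (Var.cons .z fun _ x => .s (.s x)) : S.Tm (A :: A :: Γ) B).inst (.var .z) = t := by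
  rw [inst, rename_subst]
  conv_rhs => rw [← subst_var t]
  exact subst_congr _ (Var.cons_congr rfl fun _ _ => rfl)

end Tm

/-! ### Compatibility of βη-equality with substitution -/

theorem Conv.subst {Γ Δ : S.Ctx} {A : Ty S.Base} {t t' : S.Tm Γ A} (h : S.Conv t t')
    (γ : ∀ B, Var Γ B → S.Tm Δ B) : S.Conv (t.subst γ) (t'.subst γ) := by
  cases h with
  | fnBeta t v => rw [Tm.inst_subst]; exact .fnBeta _ _
  | fnEta t =>
    simp only [Tm.subst, Tm.wk_subst_lift]
    exact .fnEta _
  | fstBeta t v => exact .fstBeta _ _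
  | sndBeta t v => exact .sndBeta _ _
  | prodEta t => exact .prodEta _
  | oneEta t => exact .oneEta _

namespace TmEq

theorem subst {Γ Δ : S.Ctx} {A : Ty S.Base} {t t' : S.Tm Γ A} (h : S.TmEq t t')
    (γ : ∀ B, Var Γ B → S.Tm Δ B) : S.TmEq (t.subst γ) (t'.subst γ) := by
  induction h generalizing Δ with
  | conv h => exact .conv (h.subst γ)
  | refl t => exact .refl _
  | symm _ ih => exact .symm (ih γ)
  | trans _ _ ih₁ ih₂ => exact .trans (ih₁ γ) (ih₂ γ)
  | sym f _ ih => exact .sym f fun B x => ih B x γ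
  | up h _ ih => exact .up h (ih γ)
  | dn h _ ih => exact .dn h (ih γ)
  | lam _ ih => exact .lam (ih _)
  | ap _ _ ih₁ ih₂ => exact .ap (ih₁ γ) (ih₂ γ)
  | pair _ _ ih₁ ih₂ => exact .pair (ih₁ γ) (ih₂ γ)
  | fst _ ih => exact .fst (ih γ)
  | snd _ ih => exact .snd (ih γ)

theorem wk {Γ : S.Ctx} {A B : Ty S.Base} {t t' : S.Tm Γ A} (h : S.TmEq t t') :
    S.TmEq (t.wk (B := B)) t'.wk := by
  rw [Tm.wk, Tm.wk, Tm.rename_eq_subst, Tm.rename_eq_subst]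
  exact h.subst _

/-- Here the induction is on the term, whereas `TmEq.subst` is by induction on the derivation.
Together they make composition of classes independent of representatives. -/
theorem subst_right {Γ Δ : S.Ctx} {A : Ty S.Base} (t : S.Tm Γ A)
    {γ γ' : ∀ B, Var Γ B → S.Tm Δ B} (h : ∀ B x, S.TmEq (γ B x) (γ' B x)) :
    S.TmEq (t.subst γ) (t.subst γ') := by
  induction t generalizing Δ with
  | var x => exact h _ x
  | sym f _ ih => exact .sym f fun B x => ih B x h
  | up hA _ ih => exact .up hA (ih h)
  | dn hA _ ih => exact .dn hA (ih h)
  | err A => exact .refl _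
  | lam t ih =>
    refine .lam (ih fun B x => ?_)
    cases x with
    | z => exact .refl _
    | s x => exact (h B x).wk
  | ap _ _ ih₁ ih₂ => exact .ap (ih₁ h) (ih₂ h)
  | pair _ _ ih₁ ih₂ => exact .pair (ih₁ h) (ih₂ h)
  | fst _ ih => exact .fst (ih h)
  | snd _ ih => exact .snd (ih h)
  | unit => exact .refl _

theorem subst_both {Γ Δ : S.Ctx} {A : Ty S.Base} {t t' : S.Tm Γ A} (h : S.TmEq t t')
    {γ γ' : ∀ B, Var Γ B → S.Tm Δ B} (hγ : ∀ B x, S.TmEq (γ B x) (γ' B x)) :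
    S.TmEq (t.subst γ) (t'.subst γ') :=
  (h.subst γ).trans (subst_right t' hγ)

theorem of_eq {Γ : S.Ctx} {A : Ty S.Base} {t t' : S.Tm Γ A} (h : t = t') : S.TmEq t t' :=
  h ▸ .refl t

end TmEq

/-! ### Derived properties of type and term dynamism -/

theorem CtxDyn.refl (Γ : S.Ctx) : S.CtxDyn Γ Γ := List.forall₂_same.2 fun A _ => .refl A

theorem CtxDyn.trans {Γ₁ Γ₂ Γ₃ : S.Ctx} (h : S.CtxDyn Γ₁ Γ₂) (h' : S.CtxDyn Γ₂ Γ₃) :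
    S.CtxDyn Γ₁ Γ₃ := by
  induction h generalizing Γ₃ with
  | nil => exact h'
  | cons h _ ih => cases h' with
    | cons k ks => exact .cons (h.trans k) (ih ks)

theorem CtxDyn.lookup {Γ Γ' : S.Ctx} (h : S.CtxDyn Γ Γ') {A A' : Ty S.Base} (x : Var Γ A)
    (x' : Var Γ' A') (hx : x.idx = x'.idx) : S.TyDyn A A' := by
  induction x generalizing Γ' with
  | z => cases h with
    | cons h _ => cases x' with
      | z => exact h
      | s x' => simp [Var.idx] at hx
  | s x ih => cases h with
    | cons _ h => cases x' with
      | z => simp [Var.idx] at hx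
      | s x' => exact ih h x' (by simpa [Var.idx] using hx)

end PreSig

/-- Orders on substitutions match variables by position only. Within a single context a position
determines both the type and the variable, so such matching reduces to equality. -/
theorem Var.idx_inj {O : Type u} {Γ : List O} {A B : O} (x : Var Γ A) (y : Var Γ B)
    (h : x.idx = y.idx) : A = B ∧ HEq x y := by
  induction x with
  | z => cases y with
    | z => exact ⟨rfl, .rfl⟩
    | s y => simp [Var.idx] at h
  | s x ih => cases y with
    | z => simp [Var.idx] at h
    | s y =>
      obtain ⟨rfl, h⟩ := ih y (by simpa [Var.idx] using h)
      cases h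
      exact ⟨rfl, .rfl⟩

namespace GttSig

open PreSig

variable {S : GttSig.{u}}

namespace TmDyn

/-- Type dynamism cannot be inverted at `→` or `×`, since axioms may relate arbitrary compound
types. In the cases of application and projections the ordering of the result types therefore comes
from the premises on component types. -/
theorem ctx_ty {Γ Γ' : S.Ctx} {A A' : Ty S.Base} {t : S.Tm Γ A} {t' : S.Tm Γ' A'}
    (h : S.TmDyn t t') : S.CtxDyn Γ Γ' ∧ S.TyDyn A A' := by
  induction h with
  | var h hx => exact ⟨h, h.lookup _ _ hx⟩
  | comp _ hΔ _ ih => exact ⟨hΔ, ih.2⟩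
  | refl t => exact ⟨.refl _, .refl _⟩
  | trans _ _ ih₁ ih₂ => exact ⟨ih₁.1.trans ih₂.1, ih₁.2.trans ih₂.2⟩
  | ax h => exact ⟨S.tmAx_ctx _ _ h, S.tmAx_ty _ _ h⟩
  | upR h => exact ⟨.refl _, h⟩
  | upL h => exact ⟨.cons h .nil, .refl _⟩
  | dnL h => exact ⟨.refl _, h⟩
  | dnR h => exact ⟨.cons h .nil, .refl _⟩
  | retract h => exact ⟨.refl _, .refl _⟩
  | errBot t => exact ⟨.refl _, .refl _⟩
  | lamMon _ ih =>
    obtain ⟨hΓ, hB⟩ := ih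
    cases hΓ with
    | cons hA hΓ => exact ⟨hΓ, hA.fnMon hB⟩
  | apMon _ hB _ _ ih _ => exact ⟨ih.1, hB⟩
  | pairMon _ _ ih₁ ih₂ => exact ⟨ih₁.1, ih₁.2.prodMon ih₂.2⟩
  | fstMon hA _ _ ih => exact ⟨ih.1, hA⟩
  | sndMon _ hB _ ih => exact ⟨ih.1, hB⟩
  | conv _ => exact ⟨.refl _, .refl _⟩
  | convSymm _ => exact ⟨.refl _, .refl _⟩

theorem subst_right {Γ Δ : S.Ctx} {A : Ty S.Base} (t : S.Tm Γ A)
    {γ γ' : ∀ B, Var Γ B → S.Tm Δ B} (h : ∀ B x, S.TmDyn (γ B x) (γ' B x)) :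
    S.TmDyn (t.subst γ) (t.subst γ') :=
  .comp (.refl t) (.refl _) fun B B' x x' hx => by
    obtain ⟨rfl, hx⟩ := Var.idx_inj x x' hx
    cases hx
    exact h _ _

/-- Term dynamism has no congruence rule for casts. It is an instance of the substitution rule,
applied to the cast of a variable. -/
theorem up_congr {Γ : S.Ctx} {A A' : Ty S.Base} (h : S.TyDyn A A') {t t' : S.Tm Γ A}
    (ht : S.TmDyn t t') : S.TmDyn (.up h t : S.Tm Γ A') (.up h t') :=
  subst_right (.up h (.var .z)) (γ := Var.cons t Var.nil) (γ' := Var.cons t' Var.nil)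
    fun B x => by
      cases x with
      | z => exact ht
      | s x => cases x

theorem dn_congr {Γ : S.Ctx} {A A' : Ty S.Base} (h : S.TyDyn A A') {t t' : S.Tm Γ A'}
    (ht : S.TmDyn t t') : S.TmDyn (.dn h t : S.Tm Γ A) (.dn h t') :=
  subst_right (.dn h (.var .z)) (γ := Var.cons t Var.nil) (γ' := Var.cons t' Var.nil)
    fun B x => by
      cases x with
      | z => exact ht
      | s x => cases x

/-- Both directions are proved at once because the symmetry rule exchanges them. -/
theorem of_tmEq_both {Γ : S.Ctx} {A : Ty S.Base} {t t' : S.Tm Γ A} (h : S.TmEq t t') :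
    S.TmDyn t t' ∧ S.TmDyn t' t := by
  induction h with
  | conv h => exact ⟨.conv h, .convSymm h⟩
  | refl t => exact ⟨.refl _, .refl _⟩
  | symm _ ih => exact ih.symm
  | trans _ _ ih₁ ih₂ => exact ⟨ih₁.1.trans ih₂.1, ih₂.2.trans ih₁.2⟩
  | sym f _ ih =>
    -- Monotonicity of a function symbol is again substitution, into `f(x₀, …)`.
    exact ⟨subst_right (.sym f fun _ x => .var x) fun B x => (ih B x).1,
      subst_right (.sym f fun _ x => .var x) fun B x => (ih B x).2⟩
  | up h _ ih => exact ⟨up_congr h ih.1, up_congr h ih.2⟩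
  | dn h _ ih => exact ⟨dn_congr h ih.1, dn_congr h ih.2⟩
  | lam _ ih => exact ⟨.lamMon ih.1, .lamMon ih.2⟩
  | ap _ _ ih₁ ih₂ =>
    exact ⟨.apMon (.refl _) (.refl _) ih₁.1 ih₂.1, .apMon (.refl _) (.refl _) ih₁.2 ih₂.2⟩
  | pair _ _ ih₁ ih₂ => exact ⟨.pairMon ih₁.1 ih₂.1, .pairMon ih₁.2 ih₂.2⟩
  | fst _ ih => exact ⟨.fstMon (.refl _) (.refl _) ih.1, .fstMon (.refl _) (.refl _) ih.2⟩
  | snd _ ih => exact ⟨.sndMon (.refl _) (.refl _) ih.1, .sndMon (.refl _) (.refl _) ih.2⟩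

theorem of_tmEq {Γ : S.Ctx} {A : Ty S.Base} {t t' : S.Tm Γ A} (h : S.TmEq t t') :
    S.TmDyn t t' :=
  (of_tmEq_both h).1

end TmDyn

end GttSig

/-! ### Calculus of cartesian preorder multicategories -/

namespace MultiData

variable {C : MultiData.{u}}

theorem compSub_sub1 {Δ Θ : List C.Obj} {A : C.Obj} (f : C.Hom Δ A) (γ : C.Sub Θ Δ) :
    C.compSub (C.sub1 f) γ = C.sub1 (C.comp f γ) :=
  Var.cons_congr rfl fun _ x => nomatch x

theorem compSub_sub2 {Δ Θ : List C.Obj} {A B : C.Obj} (f : C.Hom Δ A) (g : C.Hom Δ B)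
    (γ : C.Sub Θ Δ) : C.compSub (C.sub2 f g) γ = C.sub2 (C.comp f γ) (C.comp g γ) :=
  Var.cons_congr rfl fun _ x => by
    cases x with
    | z => rfl
    | s x => exact nomatch x

theorem sub1_ident (A : C.Obj) : C.sub1 (C.ident A) = C.identSub [A] :=
  Var.cons_congr rfl fun _ x => nomatch x

namespace IsCpm

variable (h : C.IsCpm)

include h

theorem le_refl {Γ : List C.Obj} {A : C.Obj} (f : C.Hom Γ A) : C.LE f f := h.arr_refl _

theorem ctxLE_refl (Γ : List C.Obj) : C.CtxLE Γ Γ := List.forall₂_same.2 fun A _ => h.obj_refl A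

theorem equiv_refl (f : C.Arr) : C.ArrEquiv f f := ⟨h.arr_refl f, h.arr_refl f⟩

theorem le_of_equiv {f f' g g' : C.Arr} (hf : C.ArrEquiv f f') (hg : C.ArrEquiv g g')
    (hle : C.arrLE f g) : C.arrLE f' g' :=
  h.arr_trans _ _ _ hf.2 (h.arr_trans _ _ _ hle hg.1)

theorem le_ctx {Γ Γ' : List C.Obj} {A A' : C.Obj} {f : C.Hom Γ A} {g : C.Hom Γ' A'}
    (hf : C.LE f g) : C.CtxLE Γ Γ' := by
  have := h.src_mono _ _ hf
  rwa [f.2.1, g.2.1] at this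

theorem comp_sub1_mono {Γ Γ' : List C.Obj} {A A' B B' : C.Obj} {f : C.Hom [A] B}
    {f' : C.Hom [A'] B'} {g : C.Hom Γ A} {g' : C.Hom Γ' A'} (hf : C.LE f f') (hg : C.LE g g') :
    C.LE (C.comp f (C.sub1 g)) (C.comp f' (C.sub1 g')) :=
  h.comp_mono _ _ _ _ hf ⟨h.le_ctx hg, h.le_ctx hf, fun B B' x x' hx => by
    cases x with
    | z => cases x' with
      | z => exact hg
      | s x => exact nomatch x
    | s x => exact nomatch x⟩

theorem comp_sub2_mono {Γ Γ' : List C.Obj} {A A' A₂ A₂' B B' : C.Obj} {f : C.Hom [A, A₂] B}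
    {f' : C.Hom [A', A₂'] B'} {g₁ : C.Hom Γ A} {g₁' : C.Hom Γ' A'} {g₂ : C.Hom Γ A₂}
    {g₂' : C.Hom Γ' A₂'} (hf : C.LE f f') (hg₁ : C.LE g₁ g₁') (hg₂ : C.LE g₂ g₂') :
    C.LE (C.comp f (C.sub2 g₁ g₂)) (C.comp f' (C.sub2 g₁' g₂')) :=
  h.comp_mono _ _ _ _ hf ⟨h.le_ctx hg₁, h.le_ctx hf, fun B B' x x' hx => by
    cases x with
    | z => cases x' with
      | z => exact hg₁
      | s x => simp [Var.idx] at hx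
    | s x => cases x' with
      | z => simp [Var.idx] at hx
      | s x' => cases x with
        | z => cases x' with
          | z => exact hg₂
          | s x => exact nomatch x
        | s x => exact nomatch x⟩

theorem comp_sub1_ident {A B : C.Obj} (f : C.Hom [A] B) : C.comp f (C.sub1 (C.ident A)) = f := by
  rw [sub1_ident, h.comp_ident]

theorem ident_comp_sub1 {Γ : List C.Obj} {A : C.Obj} (f : C.Hom Γ A) :
    C.comp (C.ident A) (C.sub1 f) = f :=
  h.proj_comp _ _

theorem comp_sub1_comp {Γ Δ : List C.Obj} {A B : C.Obj} (f : C.Hom [A] B) (g : C.Hom Γ A)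
    (γ : C.Sub Δ Γ) : C.comp (C.comp f (C.sub1 g)) γ = C.comp f (C.sub1 (C.comp g γ)) := by
  rw [h.assoc, compSub_sub1]

theorem comp_sub2_comp {Γ Δ : List C.Obj} {A A' B : C.Obj} (f : C.Hom [A, A'] B)
    (g : C.Hom Γ A) (g' : C.Hom Γ A') (γ : C.Sub Δ Γ) :
    C.comp (C.comp f (C.sub2 g g')) γ = C.comp f (C.sub2 (C.comp g γ) (C.comp g' γ)) := by
  rw [h.assoc, compSub_sub2]

/-- `f = f ∘ id_A ⊑ id_A' ∘ g = g`. Hence upcasts are unique up to order-equivalence. -/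
theorem upcast_le {A A' : C.Obj} {f g : C.Hom [A] A'} (hf : C.IsUpcast f) (hg : C.IsUpcast g) :
    C.LE f g := by
  have := h.comp_sub1_mono hf.1 hg.2
  rwa [h.comp_sub1_ident, h.ident_comp_sub1] at this

/-- Dually, `f = id_A ∘ f ⊑ g ∘ id_A' = g`. -/
theorem downcast_le {A A' : C.Obj} {f g : C.Hom [A'] A} (hf : C.IsDowncast f)
    (hg : C.IsDowncast g) : C.LE f g := by
  have := h.comp_sub1_mono hg.2 hf.1
  rwa [h.comp_sub1_ident, h.ident_comp_sub1] at this

theorem proj_equiv {Γ Γ' : List C.Obj} {A A' : C.Obj} (x : Var Γ A) (x' : Var Γ' A')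
    (hΓ : Γ = Γ') (hx : x.idx = x'.idx) : C.ArrEquiv (C.proj x).1 (C.proj x').1 := by
  subst hΓ
  exact ⟨h.proj_mono _ _ (h.ctxLE_refl _) hx, h.proj_mono _ _ (h.ctxLE_refl _) hx.symm⟩

end IsCpm

end MultiData

/-! ### The syntax as a GTT category -/

section Syn

open PreSig GttSig

variable {S : GttSig.{u}}

/-- `Quot` identifies along the generated equivalence relation, and `TmEq` is already an equivalence
relation. -/
theorem mk_eq_iff {Γ : S.Ctx} {A : Ty S.Base} {t t' : S.Tm Γ A} :
    (Quot.mk _ t : TmQ S Γ A) = Quot.mk _ t' ↔ S.TmEq t t' := by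
  refine ⟨fun e => ?_, fun h => Quot.sound h⟩
  have key : ∀ {t t' : S.Tm Γ A}, Relation.EqvGen S.TmEq t t' → S.TmEq t t' := by
    intro t t' h
    induction h with
    | rel _ _ h => exact h
    | refl t => exact .refl t
    | symm _ _ _ ih => exact ih.symm
    | trans _ _ _ _ _ ih₁ ih₂ => exact ih₁.trans ih₂
  exact key (Quot.eqvGen_exact e)

theorem ofHom_hom {Γ : S.Ctx} {A : Ty S.Base} (q : TmQ S Γ A) : TmQ.ofHom (TmQ.hom q) = q := by
  unfold TmQ.ofHom TmQ.hom
  simp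

theorem ofHom_cls {Γ : S.Ctx} {A : Ty S.Base} (t : S.Tm Γ A) : TmQ.ofHom (cls t) = Quot.mk _ t :=
  ofHom_hom _

theorem cls_eq_iff {Γ : S.Ctx} {A : Ty S.Base} {t t' : S.Tm Γ A} :
    cls t = cls t' ↔ S.TmEq t t' := by
  refine ⟨fun h => mk_eq_iff.1 ?_, fun h => ?_⟩
  · rw [← ofHom_cls, ← ofHom_cls, h]
  · rw [cls, cls, mk_eq_iff.2 h]

theorem cls_repr {Γ : S.Ctx} {A : Ty S.Base} (f : (synMulti S).Hom Γ A) : cls (repr f) = f := by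
  obtain ⟨⟨Γ, A, q⟩, rfl, rfl⟩ := f
  change cls (repr (TmQ.hom q)) = TmQ.hom q
  rw [cls, repr, ofHom_hom]
  exact congrArg _ (Quot.out_eq q)

/-- With this and the computation rules for `cls` below, each law of the syntactic category becomes
a statement about terms, free of chosen representatives. -/
theorem exists_cls {Γ : S.Ctx} {A : Ty S.Base} (f : (synMulti S).Hom Γ A) : ∃ t, cls t = f :=
  ⟨_, cls_repr f⟩

theorem exists_cls_sub {Γ Δ : S.Ctx} (γ : (synMulti S).Sub Δ Γ) :
    ∃ γ' : ∀ B, Var Γ B → S.Tm Δ B, (fun B x => cls (γ' B x)) = γ :=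
  ⟨fun B x => repr (γ B x), by funext B x; exact cls_repr _⟩

theorem repr_cls {Γ : S.Ctx} {A : Ty S.Base} (t : S.Tm Γ A) : S.TmEq (repr (cls t)) t :=
  cls_eq_iff.1 (cls_repr _)

/-- The order asks only for some related representatives. Any others are βη-equal to them, and
βη-equality implies dynamism. -/
theorem le_cls_iff {Γ Γ' : S.Ctx} {A A' : Ty S.Base} {t : S.Tm Γ A} {t' : S.Tm Γ' A'} :
    (synMulti S).LE (cls t) (cls t') ↔ S.TmDyn t t' := by
  refine ⟨fun ⟨r, r', h, h', hr⟩ => ?_, fun h => ⟨t, t', rfl, rfl, h⟩⟩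
  exact (TmDyn.of_tmEq (mk_eq_iff.1 h).symm).trans (hr.trans (TmDyn.of_tmEq (mk_eq_iff.1 h')))

theorem comp_cls {Γ Δ : S.Ctx} {A : Ty S.Base} (t : S.Tm Γ A) (γ : ∀ B, Var Γ B → S.Tm Δ B) :
    (synData S).comp (cls t) (fun B x => cls (γ B x)) = cls (t.subst γ) :=
  cls_eq_iff.2 ((repr_cls t).subst_both fun B x => repr_cls (γ B x))

theorem lam_cls {Γ : S.Ctx} {A B : Ty S.Base} (t : S.Tm (A :: Γ) B) :
    (synData S).lam (cls t) = cls (.lam t) :=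
  cls_eq_iff.2 (.lam (repr_cls t))

theorem pair_cls {Γ : S.Ctx} {A B : Ty S.Base} (t : S.Tm Γ A) (t' : S.Tm Γ B) :
    (synData S).pair (cls t) (cls t') = cls (.pair t t') :=
  cls_eq_iff.2 (.pair (repr_cls t) (repr_cls t'))

theorem sub1_cls {Γ : S.Ctx} {A : Ty S.Base} (t : S.Tm Γ A) :
    (synData S).sub1 (cls t) =
      fun B x => cls (Var.cons (P := S.Tm Γ) t Var.nil B x) :=
  Var.cons_congr rfl fun _ x => nomatch x

theorem sub2_cls {Γ : S.Ctx} {A B : Ty S.Base} (t : S.Tm Γ A) (t' : S.Tm Γ B) :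
    (synData S).sub2 (cls t) (cls t') =
      fun B x => cls (Var.cons (P := S.Tm Γ) t (Var.cons t' Var.nil) B x) :=
  Var.cons_congr rfl fun _ x => by
    cases x with
    | z => rfl
    | s x => exact nomatch x

theorem comp_sub1_cls {Γ : S.Ctx} {A B : Ty S.Base} (t : S.Tm [A] B) (v : S.Tm Γ A) :
    (synData S).comp (cls t) ((synData S).sub1 (cls v)) = cls (t.subst (Var.cons v Var.nil)) := by
  rw [sub1_cls, comp_cls]

theorem comp_sub2_cls {Γ : S.Ctx} {A A' B : Ty S.Base} (t : S.Tm [A, A'] B) (v : S.Tm Γ A)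
    (v' : S.Tm Γ A') : (synData S).comp (cls t) ((synData S).sub2 (cls v) (cls v')) =
      cls (t.subst (Var.cons v (Var.cons v' Var.nil))) := by
  rw [sub2_cls, comp_cls]

theorem comp_wkn_cls {Γ : S.Ctx} {A B : Ty S.Base} (t : S.Tm Γ A) :
    (synData S).comp (cls t) ((synData S).wkn Γ B) = cls t.wk := by
  refine (comp_cls t fun B x => .var (.s x)).trans ?_
  rw [Tm.wk, Tm.rename_eq_subst]

theorem liftSub_cls {Γ Δ : S.Ctx} (γ : ∀ B, Var Γ B → S.Tm Δ B) (A : Ty S.Base) :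
    (synData S).liftSub (fun B x => cls (γ B x)) A =
      fun B x => cls (Var.cons (P := S.Tm (A :: Δ)) (.var .z) (fun B x => (γ B x).wk) B x) :=
  Var.cons_congr rfl fun _ _ => comp_wkn_cls _

theorem unlam_cls {Γ : S.Ctx} {A B : Ty S.Base} (t : S.Tm Γ (.fn A B)) :
    (synData S).unlam (cls t) = cls (.ap t.wk (.var .z)) := by
  refine (congrArg _ (congrArg _ (comp_wkn_cls t))).trans ?_
  exact comp_sub2_cls _ _ _

variable (S)

theorem synCpm : (synData S).IsCpm where
  obj_refl A := .refl A
  obj_trans _ _ _ h h' := h.trans h'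
  arr_refl f := by
    obtain ⟨Γ, A, q⟩ := f
    obtain ⟨t, rfl⟩ := Quot.exists_rep q
    exact ⟨t, t, rfl, rfl, .refl t⟩
  arr_trans := by
    rintro f g k ⟨t, t₁, ht, h₁, h⟩ ⟨t₂, t₃, h₂, h₃, h'⟩
    -- The two middle representatives lie in the same class, so they are βη-equal and the chain can
    -- be joined there.
    exact ⟨t, t₃, ht, h₃, h.trans ((TmDyn.of_tmEq (mk_eq_iff.1 (h₁.trans h₂.symm))).trans h')⟩
  src_mono := by
    rintro f g ⟨t, t', -, -, h⟩
    exact h.ctx_ty.1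
  tgt_mono := by
    rintro f g ⟨t, t', -, -, h⟩
    exact h.ctx_ty.2
  proj_mono x x' h hx := le_cls_iff.2 (.var h hx)
  comp_mono f f' γ γ' hf hγ := by
    obtain ⟨t, rfl⟩ := exists_cls f
    obtain ⟨t', rfl⟩ := exists_cls f'
    obtain ⟨γ, rfl⟩ := exists_cls_sub γ
    obtain ⟨γ', rfl⟩ := exists_cls_sub γ'
    rw [comp_cls, comp_cls]
    exact le_cls_iff.2 (.comp (le_cls_iff.1 hf) hγ.1 fun B B' x x' hx =>
      le_cls_iff.1 (hγ.2.2 B B' x x' hx))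
  comp_ident f := by
    obtain ⟨t, rfl⟩ := exists_cls f
    refine (comp_cls _ _).trans ?_
    rw [Tm.subst_var]
  proj_comp x γ := by
    obtain ⟨γ, rfl⟩ := exists_cls_sub γ
    exact comp_cls _ _
  assoc f γ δ := by
    obtain ⟨t, rfl⟩ := exists_cls f
    obtain ⟨γ, rfl⟩ := exists_cls_sub γ
    obtain ⟨δ, rfl⟩ := exists_cls_sub δ
    have e : (synData S).compSub (fun B x => cls (γ B x)) (fun B x => cls (δ B x)) =
        fun B x => cls ((γ B x).subst δ) := by
      funext B x
      exact comp_cls _ _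
    rw [e]
    refine (congrArg (fun f => (synData S).comp f fun B x => cls (δ B x)) (comp_cls t γ)).trans ?_
    rw [comp_cls, comp_cls, Tm.subst_subst]

variable {S}

theorem isUpcast_cls {A A' : Ty S.Base} (h : S.TyDyn A A') :
    (synData S).IsUpcast (cls (.up h (.var .z) : S.Tm [A] A')) :=
  ⟨le_cls_iff.2 (.upL h), le_cls_iff.2 (.upR h)⟩

theorem isDowncast_cls {A A' : Ty S.Base} (h : S.TyDyn A A') :
    (synData S).IsDowncast (cls (.dn h (.var .z) : S.Tm [A'] A)) :=
  ⟨le_cls_iff.2 (.dnL h), le_cls_iff.2 (.dnR h)⟩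

theorem isBot_cls_err (Γ : S.Ctx) (A : Ty S.Base) :
    (synMulti S).IsBot (cls (.err A : S.Tm Γ A)) := fun f => by
  obtain ⟨t, rfl⟩ := exists_cls f
  exact le_cls_iff.2 (.errBot t)

variable (S)

theorem synLaws : (synData S).IsGttCat where
  toIsCpm := synCpm S
  le_top A := .dynTop A
  fn_mono _ _ _ _ h h' := h.fnMon h'
  lam_mono f f' h := by
    obtain ⟨t, rfl⟩ := exists_cls f
    obtain ⟨t', rfl⟩ := exists_cls f'
    rw [lam_cls, lam_cls]
    exact le_cls_iff.2 (.lamMon (le_cls_iff.1 h))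
  app_mono A A' B B' h h' := by
    have hc : S.CtxDyn [A, .fn A B] [A', .fn A' B'] := .cons h (.cons (h.fnMon h') .nil)
    exact le_cls_iff.2 (.apMon h h' (.var hc rfl) (.var hc rfl))
  lam_natural f γ := by
    obtain ⟨t, rfl⟩ := exists_cls f
    obtain ⟨γ, rfl⟩ := exists_cls_sub γ
    rw [lam_cls, comp_cls, liftSub_cls]
    refine Eq.trans ?_ (congrArg _ (comp_cls _ _).symm)
    rw [lam_cls]
    rfl
  unlam_lam f := by
    obtain ⟨t, rfl⟩ := exists_cls f
    rw [lam_cls, unlam_cls, cls_eq_iff]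
    -- The inverse laws of `lam` and `unlam` are the β and η laws for functions.
    refine (TmEq.conv (.fnBeta _ _)).trans (.of_eq ?_)
    exact Tm.rename_inst_z t
  lam_unlam f := by
    obtain ⟨t, rfl⟩ := exists_cls f
    rw [unlam_cls, lam_cls, cls_eq_iff]
    exact (TmEq.conv (.fnEta t)).symm
  prod_mono _ _ _ _ h h' := h.prodMon h'
  pair_mono f f' g g' h h' := by
    obtain ⟨t, rfl⟩ := exists_cls f
    obtain ⟨t', rfl⟩ := exists_cls f'
    obtain ⟨v, rfl⟩ := exists_cls g
    obtain ⟨v', rfl⟩ := exists_cls g'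
    rw [pair_cls, pair_cls]
    exact le_cls_iff.2 (.pairMon (le_cls_iff.1 h) (le_cls_iff.1 h'))
  fst_mono A A' B B' h h' :=
    le_cls_iff.2 (.fstMon h h' (.var (.cons (h.prodMon h') .nil) rfl))
  snd_mono A A' B B' h h' :=
    le_cls_iff.2 (.sndMon h h' (.var (.cons (h.prodMon h') .nil) rfl))
  pair_natural f g γ := by
    obtain ⟨t, rfl⟩ := exists_cls f
    obtain ⟨v, rfl⟩ := exists_cls g
    obtain ⟨γ, rfl⟩ := exists_cls_sub γ
    rw [pair_cls, comp_cls, comp_cls, comp_cls, pair_cls]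
    rfl
  fst_pair f g := by
    obtain ⟨t, rfl⟩ := exists_cls f
    obtain ⟨v, rfl⟩ := exists_cls g
    rw [pair_cls, comp_sub1_cls, cls_eq_iff]
    exact .conv (.fstBeta _ _)
  snd_pair f g := by
    obtain ⟨t, rfl⟩ := exists_cls f
    obtain ⟨v, rfl⟩ := exists_cls g
    rw [pair_cls, comp_sub1_cls, cls_eq_iff]
    exact .conv (.sndBeta _ _)
  pair_fst_snd f := by
    obtain ⟨t, rfl⟩ := exists_cls f
    rw [comp_sub1_cls, comp_sub1_cls, pair_cls, cls_eq_iff]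
    exact (TmEq.conv (.prodEta t)).symm
  unit_natural γ := by
    obtain ⟨γ, rfl⟩ := exists_cls_sub γ
    exact comp_cls _ _
  unit_unique f := by
    obtain ⟨t, rfl⟩ := exists_cls f
    exact cls_eq_iff.2 (.conv (.oneEta t))
  exists_upcast A A' h := ⟨_, isUpcast_cls h⟩
  exists_downcast A A' h := ⟨_, isDowncast_cls h⟩
  coreflective A A' f d h hf hd := by
    -- The rule `retract` speaks of the formal casts only; arbitrary casts lie below these by
    -- uniqueness up to order-equivalence.
    have h₁ := (synCpm S).comp_sub1_mono ((synCpm S).downcast_le hd (isDowncast_cls h))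
      ((synCpm S).upcast_le hf (isUpcast_cls h))
    rw [comp_sub1_cls] at h₁
    exact (synCpm S).arr_trans _ _ _ h₁ (le_cls_iff.2 (.retract h))
  exists_bot Γ A := ⟨_, isBot_cls_err Γ A⟩
  bot_comp {Γ Δ A} b γ hb := fun f => by
    -- A least `b` lies below the error, so `b ∘ γ` lies below the error composed with `γ`, which is
    -- again the error since substitution does not change it.
    have h₁ := (synCpm S).comp_mono _ _ γ γ (hb (cls (.err A)))
      ⟨(synCpm S).ctxLE_refl _, (synCpm S).ctxLE_refl _, fun B B' x x' hx => by
        obtain ⟨rfl, hx⟩ := Var.idx_inj x x' hx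
        cases hx
        exact (synCpm S).le_refl _⟩
    obtain ⟨γ, rfl⟩ := exists_cls_sub γ
    rw [comp_cls] at h₁
    exact (synCpm S).arr_trans _ _ _ h₁ (isBot_cls_err _ _ f)

end Syn

/-! ### Families and substitutions over the image of a context -/

namespace Var

theorem mapAll_map {O : Type u} {O' : Type w} (F : O → O') {P : O' → Type v} {Γ : List O}
    (a : ∀ A, Var Γ A → P (F A)) {A : O} (x : Var Γ A) : mapAll F a (F A) (x.map F) = a A x := by
  induction x with
  | z => rfl
  | s x ih => exact ih fun A x => a A (.s x)

/-- Sources of denotations have the form `Γ.map F`. This reduces a claim about their positions to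
positions of `Γ`, where `mapAll_map` evaluates reindexed families. -/
theorem map_cases {O : Type u} {O' : Type w} (F : O → O') {Γ : List O}
    {motive : ∀ B, Var (Γ.map F) B → Prop} (h : ∀ A (x : Var Γ A), motive (F A) (x.map F)) :
    ∀ B x, motive B x := by
  induction Γ with
  | nil => exact fun B x => nomatch x
  | cons A Γ ih =>
    intro B x
    cases x with
    | z => exact h A .z
    | s x => exact ih (motive := fun B x => motive B (.s x)) (fun A x => h A (.s x)) B x

theorem mapAll_eq {O : Type u} {O' : Type w} (F : O → O') {P : O' → Type v} {Γ : List O}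
    {a : ∀ A, Var Γ A → P (F A)} {b : ∀ B, Var (Γ.map F) B → P B}
    (h : ∀ A x, a A x = b (F A) (x.map F)) : mapAll F a = b := by
  funext B x
  revert B x
  exact map_cases F fun A x => (mapAll_map F a x).trans (h A x)

end Var

namespace MultiData

variable {C : MultiData.{w}}

theorem compSub_mapAll {O : Type u} (F : O → C.Obj) {Γ : List O} {Δ Θ : List C.Obj}
    (a : ∀ A, Var Γ A → C.Hom Δ (F A)) (γ : C.Sub Θ Δ) :
    C.compSub (Var.mapAll F (P := C.Hom Δ) a) γ =
      Var.mapAll F (P := C.Hom Θ) fun A x => C.comp (a A x) γ :=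
  (Var.mapAll_eq F fun A x => by rw [compSub, Var.mapAll_map]).symm

namespace IsCpm

variable (h : C.IsCpm)

include h

omit h in
theorem subLE_mapAll {O : Type u} {O' : Type v} {F : O → C.Obj} {G : O' → C.Obj} {Γ : List O}
    {Γ' : List O'} {Δ Δ' : List C.Obj} {a : ∀ A, Var Γ A → C.Hom Δ (F A)}
    {b : ∀ A, Var Γ' A → C.Hom Δ' (G A)} (hΔ : C.CtxLE Δ Δ') (hΓ : C.CtxLE (Γ.map F) (Γ'.map G))
    (hab : ∀ A A' (x : Var Γ A) (x' : Var Γ' A'), x.idx = x'.idx → C.LE (a A x) (b A' x')) :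
    C.SubLE (Var.mapAll F (P := C.Hom Δ) a) (Var.mapAll G (P := C.Hom Δ') b) := by
  refine ⟨hΔ, hΓ, ?_⟩
  intro B B' x x'
  revert B x
  refine Var.map_cases F fun A x => ?_
  revert B' x'
  refine Var.map_cases G fun A' x' hx => ?_
  rw [Var.mapAll_map, Var.mapAll_map]
  exact hab _ _ _ _ (by rwa [Var.idx_map, Var.idx_map] at hx)

theorem comp_sub1_equiv {Γ Γ' : List C.Obj} {A A' B B' : C.Obj} {f : C.Hom [A] B}
    {f' : C.Hom [A'] B'} {g : C.Hom Γ A} {g' : C.Hom Γ' A'} (hf : C.ArrEquiv f.1 f'.1)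
    (hg : C.ArrEquiv g.1 g'.1) :
    C.ArrEquiv (C.comp f (C.sub1 g)).1 (C.comp f' (C.sub1 g')).1 :=
  ⟨h.comp_sub1_mono hf.1 hg.1, h.comp_sub1_mono hf.2 hg.2⟩

theorem comp_sub2_equiv {Γ Γ' : List C.Obj} {A A' A₂ A₂' B B' : C.Obj} {f : C.Hom [A, A₂] B}
    {f' : C.Hom [A', A₂'] B'} {g₁ : C.Hom Γ A} {g₁' : C.Hom Γ' A'} {g₂ : C.Hom Γ A₂}
    {g₂' : C.Hom Γ' A₂'} (hf : C.ArrEquiv f.1 f'.1) (hg₁ : C.ArrEquiv g₁.1 g₁'.1)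
    (hg₂ : C.ArrEquiv g₂.1 g₂'.1) :
    C.ArrEquiv (C.comp f (C.sub2 g₁ g₂)).1 (C.comp f' (C.sub2 g₁' g₂')).1 :=
  ⟨h.comp_sub2_mono hf.1 hg₁.1 hg₂.1, h.comp_sub2_mono hf.2 hg₁.2 hg₂.2⟩

theorem upcast_equiv {A A' B B' : C.Obj} (hA : A = B) (hA' : A' = B') {f : C.Hom [A] A'}
    {g : C.Hom [B] B'} (hf : C.IsUpcast f) (hg : C.IsUpcast g) : C.ArrEquiv f.1 g.1 := by
  subst hA hA'
  exact ⟨h.upcast_le hf hg, h.upcast_le hg hf⟩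

theorem downcast_equiv {A A' B B' : C.Obj} (hA : A = B) (hA' : A' = B') {f : C.Hom [A'] A}
    {g : C.Hom [B'] B} (hf : C.IsDowncast f) (hg : C.IsDowncast g) : C.ArrEquiv f.1 g.1 := by
  subst hA hA'
  exact ⟨h.downcast_le hf hg, h.downcast_le hg hf⟩

end IsCpm

theorem equiv_of_eq_left {f f' g : C.Arr} (h : f = f') (h' : C.ArrEquiv f' g) :
    C.ArrEquiv f g := by
  rwa [h]

theorem bot_equiv {Γ Γ' : List C.Obj} {A A' : C.Obj} (hΓ : Γ = Γ') (hA : A = A')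
    {f : C.Hom Γ A} {g : C.Hom Γ' A'} (hf : C.IsBot f) (hg : C.IsBot g) :
    C.ArrEquiv f.1 g.1 := by
  subst hΓ hA
  exact ⟨hf _, hg _⟩

end MultiData

/-- The semantic β law at an arbitrary argument: write `f` as `unlam (lam f)` and compose with `(v,
id)`, which cancels the weakening inside `unlam`. -/
theorem GttData.IsGttCat.app_lam {C : GttData.{u}} (h : C.IsGttCat) {Γ : List C.Obj}
    {A B : C.Obj} (f : C.Hom (A :: Γ) B) (v : C.Hom Γ A) :
    C.comp (C.app A B) (C.sub2 v (C.lam f)) =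
      C.comp f (Var.cons v (C.identSub Γ)) := by
  conv_rhs => rw [← h.unlam_lam f]
  have e : C.compSub (C.wkn Γ A) (Var.cons v (C.identSub Γ)) = C.identSub Γ := by
    funext B x
    exact h.proj_comp _ _
  rw [GttData.unlam, h.comp_sub2_comp, h.proj_comp, h.assoc, e, h.comp_ident]
  rfl

/-! ### Preservation of denotations by morphisms -/

namespace GttFunctor

variable {C : GttCat.{u}} {D : GttCat.{v}} (F : GttFunctor C D)

/-- Upcasts are defined by inequalities with identities, which are projections. A monotone map
preserving projections thus preserves them, with no separate requirement on morphisms. -/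
theorem isUpcast {A A' : C.Obj} {f : C.Hom [A] A'} (hf : C.IsUpcast f) :
    D.IsUpcast (A := F.obj A) (A' := F.obj A') (F.hom f) := by
  have h₁ := F.arr_mono _ _ hf.1
  have h₂ := F.arr_mono _ _ hf.2
  rw [MultiData.ident, F.map_proj] at h₁ h₂
  exact ⟨h₁, h₂⟩

theorem isDowncast {A A' : C.Obj} {f : C.Hom [A'] A} (hf : C.IsDowncast f) :
    D.IsDowncast (A := F.obj A) (A' := F.obj A') (F.hom f) := by
  have h₁ := F.arr_mono _ _ hf.1
  have h₂ := F.arr_mono _ _ hf.2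
  rw [MultiData.ident, F.map_proj] at h₁ h₂
  exact ⟨h₁, h₂⟩

theorem map_comp_sub1 {Γ : List C.Obj} {A B : C.Obj} (f : C.Hom [A] B) (g : C.Hom Γ A) :
    F.arr (C.comp f (C.sub1 g)).1 =
      (D.comp (Γ := [F.obj A]) (F.hom f) (D.sub1 (F.hom g))).1 :=
  F.map_comp _ _

theorem map_comp_sub2 {Γ : List C.Obj} {A A' B : C.Obj} (f : C.Hom [A, A'] B) (g : C.Hom Γ A)
    (g' : C.Hom Γ A') : F.arr (C.comp f (C.sub2 g g')).1 =
      (D.comp (Γ := [F.obj A, F.obj A']) (F.hom f) (D.sub2 (F.hom g) (F.hom g'))).1 :=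
  F.map_comp _ _

theorem ty_eq {S : PreSig.{w}} {I : PreInterp S C} {I' : PreInterp S D}
    (hb : ∀ X, F.obj (I.base X) = I'.base X) (A : Ty S.Base) : F.obj (I.ty A) = I'.ty A := by
  induction A with
  | base X => exact hb X
  | dyn => exact F.obj_top
  | fn A B ihA ihB => exact (F.obj_fn _ _).trans (congrArg₂ D.fn ihA ihB)
  | prod A B ihA ihB => exact (F.obj_prod _ _).trans (congrArg₂ D.prod ihA ihB)
  | one => exact F.obj_one

theorem ctx_eq {S : PreSig.{w}} {I : PreInterp S C} {I' : PreInterp S D}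
    (hb : ∀ X, F.obj (I.base X) = I'.base X) (Γ : S.Ctx) :
    (Γ.map I.ty).map F.obj = Γ.map I'.ty := by
  rw [List.map_map]
  exact List.map_congr_left fun A _ => F.ty_eq hb A

/-- Structural operations are preserved strictly, while casts and bottoms chosen on the two sides
agree only up to order-equivalence; monotonicity of the operations propagates this through the term.
The identity morphism gives independence of choices, the complete signature gives the action of `U`,
and the tautological interpretation gives uniqueness in the universal property. -/
theorem tm_equiv {S : PreSig.{w}} {I : PreInterp S C} {I' : PreInterp S D}
    (hb : ∀ X, F.obj (I.base X) = I'.base X)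
    (hs : ∀ f, D.ArrEquiv (F.arr (I.sym f)) (I'.sym f)) (k : Choice C) (k' : Choice D)
    {Γ : S.Ctx} {A : Ty S.Base} (t : S.Tm Γ A) :
    D.ArrEquiv (F.arr (I.tm k t).1) (I'.tm k' t).1 := by
  have hD := D.laws.toIsCpm
  have le : ∀ Γ : S.Ctx, D.CtxLE ((Γ.map I.ty).map F.obj) (Γ.map I'.ty) := fun Γ => by
    rw [F.ctx_eq hb]
    exact hD.ctxLE_refl _
  have ge : ∀ Γ : S.Ctx, D.CtxLE (Γ.map I'.ty) ((Γ.map I.ty).map F.obj) := fun Γ => by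
    rw [F.ctx_eq hb]
    exact hD.ctxLE_refl _
  induction t with
  | var x =>
    rw [PreInterp.tm, PreInterp.tm, F.map_proj]
    exact hD.proj_equiv _ _ (F.ctx_eq hb _) (by simp only [Var.idx_map])
  | sym f args ih =>
    rw [PreInterp.tm, PreInterp.tm, F.map_comp]
    constructor
    · refine hD.comp_mono _ _ _ _ (hs f.1).1 (MultiData.IsCpm.subLE_mapAll (le _) (le _) ?_)
      intro A A' x x'
      revert A x
      -- The substitution on the side of `F` is reindexed twice, along `I.ty` and then `F.obj`. The
      -- outer reindexing was removed by `subLE_mapAll`, the inner one is removed here.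
      refine Var.map_cases _ fun A x hx => ?_
      rw [Var.mapAll_map]
      obtain ⟨rfl, hx⟩ := Var.idx_inj x x' (by rwa [Var.idx_map] at hx)
      cases hx
      exact (ih _ _).1
    · refine hD.comp_mono _ _ _ _ (hs f.1).2 (MultiData.IsCpm.subLE_mapAll (ge _) (ge _) ?_)
      intro A' A x' x
      revert A x
      refine Var.map_cases _ fun A x hx => ?_
      rw [Var.mapAll_map]
      obtain ⟨rfl, hx⟩ := Var.idx_inj x' x (by rwa [Var.idx_map] at hx)
      cases hx
      exact (ih _ _).2
  | up h t ih =>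
    refine MultiData.equiv_of_eq_left (F.map_comp_sub1 _ _) ?_
    exact hD.comp_sub1_equiv (hD.upcast_equiv (F.ty_eq hb _) (F.ty_eq hb _)
      (F.isUpcast (k.up_spec _)) (k'.up_spec _)) ih
  | dn h t ih =>
    refine MultiData.equiv_of_eq_left (F.map_comp_sub1 _ _) ?_
    exact hD.comp_sub1_equiv (hD.downcast_equiv (F.ty_eq hb _) (F.ty_eq hb _)
      (F.isDowncast (k.dn_spec _)) (k'.dn_spec _)) ih
  | err A =>
    exact MultiData.bot_equiv (F.ctx_eq hb _) (F.ty_eq hb _)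
      (F.map_bot _ (k.bot_spec _ _)) (k'.bot_spec _ _)
  | lam t ih =>
    refine MultiData.equiv_of_eq_left (F.map_lam _) ?_
    exact ⟨D.laws.lam_mono _ _ ih.1, D.laws.lam_mono _ _ ih.2⟩
  | @ap Γ A B t v ih₁ ih₂ =>
    refine MultiData.equiv_of_eq_left (F.map_comp_sub2 _ _ _) ?_
    refine hD.comp_sub2_equiv ?_ ih₂ ih₁
    refine MultiData.equiv_of_eq_left (F.map_app _ _) ?_
    rw [F.ty_eq hb, F.ty_eq hb]
    exact hD.equiv_refl _
  | pair t v ih₁ ih₂ =>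
    refine MultiData.equiv_of_eq_left (F.map_pair _ _) ?_
    exact ⟨D.laws.pair_mono _ _ _ _ ih₁.1 ih₂.1, D.laws.pair_mono _ _ _ _ ih₁.2 ih₂.2⟩
  | @fst Γ A B t ih =>
    refine MultiData.equiv_of_eq_left (F.map_comp_sub1 _ _) ?_
    refine hD.comp_sub1_equiv ?_ ih
    refine MultiData.equiv_of_eq_left (F.map_fst (I.ty A) (I.ty B)) ?_
    rw [F.ty_eq hb, F.ty_eq hb]
    exact hD.equiv_refl _
  | @snd Γ A B t ih =>
    refine MultiData.equiv_of_eq_left (F.map_comp_sub1 _ _) ?_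
    refine hD.comp_sub1_equiv ?_ ih
    refine MultiData.equiv_of_eq_left (F.map_snd (I.ty A) (I.ty B)) ?_
    rw [F.ty_eq hb, F.ty_eq hb]
    exact hD.equiv_refl _
  | unit =>
    rw [PreInterp.tm, PreInterp.tm, F.map_unit, F.ctx_eq hb]
    exact hD.equiv_refl _

end GttFunctor

/-! ### Stable choices, the substitution lemma and soundness -/

namespace Choice

variable {C : GttCat.{w}}

/-- A choice of local bottoms is stable if it is strictly preserved by composition. -/
def Stable (k : Choice C) : Prop :=
  ∀ {Γ Δ : List C.Obj} {A : C.Obj} (γ : C.Sub Δ Γ), C.comp (k.bot Γ A) γ = k.bot Δ A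

end Choice

/-- Every GTT category has a stable choice of casts and local bottoms: take the local bottoms
in the empty context and weaken them. -/
theorem exists_stable_choice (C : GttCat.{w}) : ∃ k : Choice C, k.Stable := by
  choose f hf using C.laws.exists_upcast
  choose d hd using C.laws.exists_downcast
  choose b hb using C.laws.exists_bot []
  refine ⟨⟨fun h => f _ _ h, fun h => hf _ _ h, fun h => d _ _ h, fun h => hd _ _ h,
    fun Γ A => C.comp (b A) Var.nil, fun Γ A => C.laws.bot_comp _ _ (hb A)⟩, ?_⟩
  intro Γ Δ A γ
  -- By associativity both sides compose the same bottom with a substitution into the empty context,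
  -- and there is only one such substitution.
  refine (C.laws.assoc _ _ _).trans (congrArg _ ?_)
  funext B x
  exact nomatch x

namespace PreInterp

variable {S : PreSig.{u}} {C : GttCat.{w}}

theorem tm_equiv_of_choice (I : PreInterp S C) (k k' : Choice C) {Γ : S.Ctx} {A : Ty S.Base}
    (t : S.Tm Γ A) : C.ArrEquiv (I.tm k t).1 (I.tm k' t).1 :=
  (GttFunctor.ident C).tm_equiv (fun _ => rfl) (fun _ => C.laws.equiv_refl _) k k' t

variable (I : PreInterp S C) {k : Choice C} (hk : k.Stable)

include hk

/-- This comes before the substitution lemma because that lemma meets weakened terms under a binder.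
Stability of the choice enters at errors. -/
theorem tm_rename {Γ Δ : S.Ctx} {A : Ty S.Base} (t : S.Tm Γ A) (ρ : ∀ B, Var Γ B → Var Δ B) :
    I.tm k (t.rename ρ) = C.comp (I.tm k t)
      (Var.mapAll I.ty (P := C.Hom (Δ.map I.ty)) fun B x => C.proj ((ρ B x).map I.ty)) := by
  induction t generalizing Δ with
  | var x => rw [PreSig.Tm.rename, tm, tm, C.laws.proj_comp, Var.mapAll_map]
  | sym f args ih =>
    rw [PreSig.Tm.rename, tm, tm, C.laws.assoc, MultiData.compSub_mapAll]
    simp only [ih]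
  | up h t ih =>
    exact (congrArg (fun f => C.comp _ (C.sub1 f)) (ih ρ)).trans
      (C.laws.comp_sub1_comp _ _ _).symm
  | dn h t ih =>
    exact (congrArg (fun f => C.comp _ (C.sub1 f)) (ih ρ)).trans
      (C.laws.comp_sub1_comp _ _ _).symm
  | err A => exact (hk _).symm
  | @lam Γ A B t ih =>
    refine Eq.trans (congrArg C.lam ((ih _).trans ?_)) (C.laws.lam_natural _ _).symm
    refine congrArg (C.comp _) (congrArg (Var.cons _) ?_)
    rw [MultiData.compSub_mapAll]
    refine congrArg (Var.mapAll I.ty) ?_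
    funext B x
    exact (C.laws.proj_comp ((ρ B x).map I.ty) (C.wkn (Δ.map I.ty) (I.ty A))).symm
  | ap t v ih₁ ih₂ =>
    exact (congrArg₂ (fun f g => C.comp _ (C.sub2 f g)) (ih₂ ρ) (ih₁ ρ)).trans
      (C.laws.comp_sub2_comp _ _ _ _).symm
  | pair t v ih₁ ih₂ =>
    exact (congrArg₂ C.pair (ih₁ ρ) (ih₂ ρ)).trans (C.laws.pair_natural _ _ _).symm
  | fst t ih =>
    exact (congrArg (fun f => C.comp _ (C.sub1 f)) (ih ρ)).trans
      (C.laws.comp_sub1_comp _ _ _).symm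
  | snd t ih =>
    exact (congrArg (fun f => C.comp _ (C.sub1 f)) (ih ρ)).trans
      (C.laws.comp_sub1_comp _ _ _).symm
  | unit => exact (C.laws.unit_natural _).symm

theorem tm_wk {Γ : S.Ctx} {A B : Ty S.Base} (t : S.Tm Γ A) :
    I.tm k (t.wk (B := B)) = C.comp (I.tm k t) (C.wkn (Γ.map I.ty) (I.ty B)) := by
  rw [PreSig.Tm.wk, I.tm_rename hk]
  exact congrArg _ (Var.mapAll_eq _ fun A x => rfl)

/-- A strict equality is needed here: an order-equivalence would not give βη-equal terms equal
denotations, and the denotation would not descend to classes of terms. -/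
theorem tm_subst {Γ Δ : S.Ctx} {A : Ty S.Base} (t : S.Tm Γ A) (γ : ∀ B, Var Γ B → S.Tm Δ B) :
    I.tm k (t.subst γ) = C.comp (I.tm k t)
      (Var.mapAll I.ty (P := C.Hom (Δ.map I.ty)) fun B x => I.tm k (γ B x)) := by
  induction t generalizing Δ with
  | var x => rw [PreSig.Tm.subst, tm, C.laws.proj_comp, Var.mapAll_map]
  | sym f args ih =>
    rw [PreSig.Tm.subst, tm, tm, C.laws.assoc, MultiData.compSub_mapAll]
    simp only [ih]
  | up h t ih =>
    exact (congrArg (fun f => C.comp _ (C.sub1 f)) (ih γ)).trans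
      (C.laws.comp_sub1_comp _ _ _).symm
  | dn h t ih =>
    exact (congrArg (fun f => C.comp _ (C.sub1 f)) (ih γ)).trans
      (C.laws.comp_sub1_comp _ _ _).symm
  | err A => exact (hk _).symm
  | @lam Γ A B t ih =>
    refine Eq.trans (congrArg C.lam ((ih _).trans ?_)) (C.laws.lam_natural _ _).symm
    refine congrArg (C.comp _) (congrArg (Var.cons _) ?_)
    rw [MultiData.compSub_mapAll]
    refine congrArg (Var.mapAll I.ty) ?_
    funext B x
    exact I.tm_wk hk _
  | ap t v ih₁ ih₂ =>
    exact (congrArg₂ (fun f g => C.comp _ (C.sub2 f g)) (ih₂ γ) (ih₁ γ)).trans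
      (C.laws.comp_sub2_comp _ _ _ _).symm
  | pair t v ih₁ ih₂ =>
    exact (congrArg₂ C.pair (ih₁ γ) (ih₂ γ)).trans (C.laws.pair_natural _ _ _).symm
  | fst t ih =>
    exact (congrArg (fun f => C.comp _ (C.sub1 f)) (ih γ)).trans
      (C.laws.comp_sub1_comp _ _ _).symm
  | snd t ih =>
    exact (congrArg (fun f => C.comp _ (C.sub1 f)) (ih γ)).trans
      (C.laws.comp_sub1_comp _ _ _).symm
  | unit => exact (C.laws.unit_natural _).symm

/-- For functions, β is `app_lam` together with the substitution lemma, and η is `lam_unlam`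
together with weakening; the other laws are those of the chosen structure. -/
theorem tm_conv {Γ : S.Ctx} {A : Ty S.Base} {t t' : S.Tm Γ A} (h : S.Conv t t') :
    I.tm k t = I.tm k t' := by
  cases h with
  | fnBeta t v =>
    refine (C.laws.app_lam _ _).trans ?_
    rw [PreSig.Tm.inst, I.tm_subst hk]
    refine congrArg (C.comp _) (congrArg (Var.cons _) ?_)
    exact (Var.mapAll_eq _ fun A x => rfl).symm
  | fnEta =>
    refine (C.laws.lam_unlam _).symm.trans (congrArg C.lam ?_)
    exact congrArg (fun f => C.comp _ (C.sub2 _ f)) (I.tm_wk hk _).symm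
  | fstBeta t v => exact C.laws.fst_pair _ _
  | sndBeta t v => exact C.laws.snd_pair _ _
  | prodEta => exact (C.laws.pair_fst_snd _).symm
  | oneEta => exact C.laws.unit_unique _

theorem tm_tmEq {Γ : S.Ctx} {A : Ty S.Base} {t t' : S.Tm Γ A} (h : S.TmEq t t') :
    I.tm k t = I.tm k t' := by
  induction h with
  | conv h => exact I.tm_conv hk h
  | refl t => rfl
  | symm _ ih => exact ih.symm
  | trans _ _ ih₁ ih₂ => exact ih₁.trans ih₂
  | sym f _ ih => simp only [tm, ih]
  | up h _ ih => simp only [tm, ih]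
  | dn h _ ih => simp only [tm, ih]
  | lam _ ih => rw [tm, tm, ih]
  | ap _ _ ih₁ ih₂ => rw [tm, tm, ih₁, ih₂]
  | pair _ _ ih₁ ih₂ => rw [tm, tm, ih₁, ih₂]
  | fst _ ih => rw [tm, tm, ih]
  | snd _ ih => rw [tm, tm, ih]

end PreInterp

namespace Interp

variable {S : GttSig.{u}} {C : GttCat.{w}}

/-- The axioms hold for one choice of casts and local bottoms if they hold for another. -/
def changeChoice {k : Choice C} (I : Interp S C k) (k' : Choice C) : Interp S C k' where
  toPreInterp := I.toPreInterp
  tmAx t t' h := C.laws.le_of_equiv (I.tm_equiv_of_choice k k' _) (I.tm_equiv_of_choice k k' _)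
    (I.tmAx t t' h)

theorem ty_le {k : Choice C} (I : Interp S C k) {A A' : Ty S.Base} (h : S.TyDyn A A') :
    C.objLE (I.ty A) (I.ty A') :=
  GttCat.ty_le I.tyAx h

theorem ctx_le {k : Choice C} (I : Interp S C k) {Γ Γ' : S.Ctx} (h : S.CtxDyn Γ Γ') :
    C.CtxLE (Γ.map I.ty) (Γ'.map I.ty) := by
  induction h with
  | nil => exact .nil
  | cons h _ ih => exact .cons (I.ty_le h) ih

/-- By induction on the derivation. The substitution rule becomes monotonicity of composition
through `tm_subst`, and each remaining rule matches a law of GTT categories or of the choice. -/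
theorem tm_le_of_stable {k : Choice C} (I : Interp S C k) (hk : k.Stable) {Γ Γ' : S.Ctx}
    {A A' : Ty S.Base} {t : S.Tm Γ A} {t' : S.Tm Γ' A'} (h : S.TmDyn t t') :
    C.LE (I.tm k t) (I.tm k t') := by
  have hC := C.laws.toIsCpm
  induction h with
  | var hΓ hx => exact hC.proj_mono _ _ (I.ctx_le hΓ) (by rwa [Var.idx_map, Var.idx_map])
  | comp h hΔ _ ih₁ ih₂ =>
    rw [I.tm_subst hk, I.tm_subst hk]
    exact hC.comp_mono _ _ _ _ ih₁
      (MultiData.IsCpm.subLE_mapAll (I.ctx_le hΔ) (I.ctx_le h.ctx_ty.1) ih₂)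
  | refl t => exact hC.le_refl _
  | trans _ _ ih₁ ih₂ => exact hC.arr_trans _ _ _ ih₁ ih₂
  | ax h => exact I.tmAx _ _ h
  | upR h =>
    -- A cast of a variable denotes the chosen cast composed with an identity, that is, the chosen
    -- cast itself. The same applies to the next three cases.
    refine Eq.mpr (congrArg (C.LE _) (hC.comp_sub1_ident _)) ?_
    exact (k.up_spec _).2
  | upL h =>
    refine Eq.mpr (congrArg (C.LE · _) (hC.comp_sub1_ident _)) ?_
    exact (k.up_spec _).1
  | dnL h =>
    refine Eq.mpr (congrArg (C.LE · _) (hC.comp_sub1_ident _)) ?_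
    exact (k.dn_spec _).1
  | dnR h =>
    refine Eq.mpr (congrArg (C.LE _) (hC.comp_sub1_ident _)) ?_
    exact (k.dn_spec _).2
  | retract h =>
    refine Eq.mpr (congrArg (fun f => C.LE (C.comp _ (C.sub1 f)) _) (hC.comp_sub1_ident _)) ?_
    exact C.laws.coreflective _ _ _ _ (I.ty_le h) (k.up_spec _) (k.dn_spec _)
  | errBot t => exact k.bot_spec _ _ _
  | lamMon _ ih => exact C.laws.lam_mono _ _ ih
  | apMon hA hB _ _ ih₁ ih₂ =>
    exact hC.comp_sub2_mono (C.laws.app_mono _ _ _ _ (I.ty_le hA) (I.ty_le hB)) ih₂ ih₁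
  | pairMon _ _ ih₁ ih₂ => exact C.laws.pair_mono _ _ _ _ ih₁ ih₂
  | fstMon hA hB _ ih =>
    exact hC.comp_sub1_mono (C.laws.fst_mono _ _ _ _ (I.ty_le hA) (I.ty_le hB)) ih
  | sndMon hA hB _ ih =>
    exact hC.comp_sub1_mono (C.laws.snd_mono _ _ _ _ (I.ty_le hA) (I.ty_le hB)) ih
  | conv h => rw [I.tm_conv hk h]; exact hC.le_refl _
  | convSymm h => rw [I.tm_conv hk h]; exact hC.le_refl _

/-- Stability is only auxiliary. Denotations under the given choice and a stable one are
order-equivalent, so both the axioms and the conclusion pass between them. -/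
theorem tm_le {k : Choice C} (I : Interp S C k) {Γ Γ' : S.Ctx} {A A' : Ty S.Base}
    {t : S.Tm Γ A} {t' : S.Tm Γ' A'} (h : S.TmDyn t t') : C.LE (I.tm k t) (I.tm k t') := by
  obtain ⟨k', hk'⟩ := exists_stable_choice C
  exact C.laws.le_of_equiv (I.tm_equiv_of_choice k' k t) (I.tm_equiv_of_choice k' k t')
    ((I.changeChoice k').tm_le_of_stable hk' h)

end Interp

/-! ### Transport of multiarrows along equalities of contexts and types -/

theorem Var.heq_of_idx {O : Type u} {Γ Γ' : List O} {A A' : O} (hΓ : Γ = Γ') {x : Var Γ A}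
    {y : Var Γ' A'} (h : x.idx = y.idx) : HEq x y := by
  subst hΓ
  exact (Var.idx_inj x y h).2

theorem PreMulti.sub_heq {C : PreMulti.{u}} {Γ Γ' Δ Δ' : List C.Obj} (hΓ : Γ = Γ') (hΔ : Δ = Δ')
    {γ : C.Sub Δ Γ} {δ : C.Sub Δ' Γ'} (h : ∀ B B' (x : Var Γ B) (x' : Var Γ' B'),
      x.idx = x'.idx → (γ B x).1 = (δ B' x').1) : HEq γ δ := by
  subst hΓ hΔ
  exact heq_of_eq (by funext B x; exact Subtype.ext (h B B x x rfl))

namespace MultiData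

variable {C : MultiData.{u}}

theorem sub2_proj (A B : C.Obj) :
    C.sub2 (C.proj (.z : Var [A, B] A)) (C.proj (.s .z)) = C.identSub [A, B] :=
  Var.cons_congr rfl fun _ x => by
    cases x with
    | z => rfl
    | s x => exact nomatch x

theorem comp_sub1_val {Γ Γ' : List C.Obj} {A A' B B' : C.Obj} (hΓ : Γ = Γ') (hA : A = A')
    (hB : B = B') {f : C.Hom [A] B} {f' : C.Hom [A'] B'} (hf : f.1 = f'.1) {g : C.Hom Γ A}
    {g' : C.Hom Γ' A'} (hg : g.1 = g'.1) :
    (C.comp f (C.sub1 g)).1 = (C.comp f' (C.sub1 g')).1 := by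
  subst hΓ hA hB
  rw [Subtype.ext hf, Subtype.ext hg]

theorem comp_sub2_val {Γ Γ' : List C.Obj} {A A' A₂ A₂' B B' : C.Obj} (hΓ : Γ = Γ') (hA : A = A')
    (hA₂ : A₂ = A₂') (hB : B = B') {f : C.Hom [A, A₂] B} {f' : C.Hom [A', A₂'] B'}
    (hf : f.1 = f'.1) {g₁ : C.Hom Γ A} {g₁' : C.Hom Γ' A'} (hg₁ : g₁.1 = g₁'.1)
    {g₂ : C.Hom Γ A₂} {g₂' : C.Hom Γ' A₂'} (hg₂ : g₂.1 = g₂'.1) :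
    (C.comp f (C.sub2 g₁ g₂)).1 = (C.comp f' (C.sub2 g₁' g₂')).1 := by
  subst hΓ hA hA₂ hB
  rw [Subtype.ext hf, Subtype.ext hg₁, Subtype.ext hg₂]

end MultiData

namespace GttData

variable (C : GttData.{u}) {A A' B B' : C.Obj}

theorem app_val (hA : A = A') (hB : B = B') : (C.app A B).1 = (C.app A' B').1 := by
  subst hA hB
  rfl

theorem fst_val (hA : A = A') (hB : B = B') : (C.fst A B).1 = (C.fst A' B').1 := by
  subst hA hB
  rfl

theorem snd_val (hA : A = A') (hB : B = B') : (C.snd A B).1 = (C.snd A' B').1 := by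
  subst hA hB
  rfl

theorem unit_val {Γ Γ' : List C.Obj} (hΓ : Γ = Γ') : (C.unit Γ).1 = (C.unit Γ').1 := by
  subst hΓ
  rfl

end GttData

namespace Choice

variable {C : GttCat.{u}} (k : Choice C)

theorem up_val {A A' B B' : C.Obj} (hA : A = B) (hA' : A' = B') (h : C.objLE A A')
    (h' : C.objLE B B') : (k.up h).1 = (k.up h').1 := by
  subst hA hA'
  rfl

theorem dn_val {A A' B B' : C.Obj} (hA : A = B) (hA' : A' = B') (h : C.objLE A A')
    (h' : C.objLE B B') : (k.dn h).1 = (k.dn h').1 := by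
  subst hA hA'
  rfl

theorem bot_val {Γ Γ' : List C.Obj} {A A' : C.Obj} (hΓ : Γ = Γ') (hA : A = A') :
    (k.bot Γ A).1 = (k.bot Γ' A').1 := by
  subst hΓ hA
  rfl

end Choice

/-! ## Precomposition of interpretations with translations -/

namespace PreInterp

variable {S T : PreSig.{u}} {C : GttCat.{w}}

/-- Precomposition of an interpretation with a translation. -/
def precomp (I : PreInterp T C) (i : PreTrans S T) : PreInterp S C where
  base := I.base ∘ i.base
  tyAx A A' h := by
    rw [← C.ty_map, ← C.ty_map]
    exact I.tyAx _ _ (i.tyAx _ _ h)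
  sym := I.sym ∘ i.sym
  src f := by
    rw [Function.comp_apply, I.src, i.src, List.map_map]
    exact List.map_congr_left fun A _ => C.ty_map _ _ A
  tgt f := by
    rw [Function.comp_apply, I.tgt, i.tgt]
    exact C.ty_map _ _ _

variable (I : PreInterp T C) (i : PreTrans S T)

theorem precomp_ty (A : Ty S.Base) : (I.precomp i).ty A = I.ty (A.map i.base) :=
  (C.ty_map i.base I.base A).symm

theorem precomp_ctx (Γ : S.Ctx) :
    Γ.map (I.precomp i).ty = (Γ.map (Ty.map i.base)).map I.ty := by
  rw [List.map_map]
  exact List.map_congr_left fun A _ => I.precomp_ty i A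

/-- The same `k` serves both sides, so casts and errors match exactly and no stability is required.
The two hom-sets have only propositionally equal indices, hence the equation between underlying
multiarrows. -/
theorem precomp_tm (k : Choice C) {Γ : S.Ctx} {A : Ty S.Base} (t : S.Tm Γ A) :
    ((I.precomp i).tm k t).1 = (I.tm k (i.tm t)).1 := by
  have hc := I.precomp_ctx i
  have ha := I.precomp_ty i
  induction t with
  | var x =>
    exact PreFunctor.proj_val (hc _) (ha _)
      (Var.heq_of_idx (hc _) (by simp only [Var.idx_map]))
  | sym f args ih =>
    refine PreFunctor.comp_val (hc _) (hc _) (ha _) rfl (PreMulti.sub_heq (hc _) (hc _) ?_)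
    intro B B' x x'
    revert B x
    refine Var.map_cases _ fun B x => ?_
    revert B' x'
    refine Var.map_cases _ (Var.map_cases _ fun B' x' hx => ?_)
    obtain ⟨rfl, hx⟩ := Var.idx_inj x x' (by simpa only [Var.idx_map] using hx)
    cases hx
    rw [Var.mapAll_map, Var.mapAll_map, Var.mapAll_map]
    exact ih B x
  | up h t ih =>
    exact MultiData.comp_sub1_val (hc _) (ha _) (ha _) (k.up_val (ha _) (ha _) _ _) ih
  | dn h t ih =>
    exact MultiData.comp_sub1_val (hc _) (ha _) (ha _) (k.dn_val (ha _) (ha _) _ _) ih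
  | err A => exact k.bot_val (hc _) (ha _)
  | lam t ih => exact PreFunctor.lam_val (hc _) (ha _) (ha _) ih
  | ap t v ih₁ ih₂ =>
    exact MultiData.comp_sub2_val (hc _) (ha _) (ha (.fn _ _)) (ha _)
      (C.app_val (ha _) (ha _)) ih₂ ih₁
  | pair t v ih₁ ih₂ => exact PreFunctor.pair_val (hc _) (ha _) (ha _) ih₁ ih₂
  | @fst Γ A B t ih =>
    exact MultiData.comp_sub1_val (hc _) (ha (.prod _ _)) (ha _)
      (C.fst_val (ha A) (ha B)) ih
  | @snd Γ A B t ih =>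
    exact MultiData.comp_sub1_val (hc _) (ha (.prod _ _)) (ha _)
      (C.snd_val (ha A) (ha B)) ih
  | unit => exact C.unit_val (hc _)

end PreInterp

/-! ## The functor from the syntax given by an interpretation -/

namespace Interp

variable {S : GttSig.{u}} {C : GttCat.{w}} {k : Choice C}

/-- An interpretation with respect to stable local bottoms extends to a functor defined on the
syntactic GTT category. -/
noncomputable def functor (I : Interp S C k) (hk : k.Stable) :
    GttFunctor (synCat synLaws S) C where
  obj := I.ty
  -- Stability makes this well defined on βη-classes.
  arr f := (Quot.lift (I.tm k) (fun _ _ h => I.tm_tmEq hk h) f.2.2).1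
  src f := (Quot.lift (I.tm k) (fun _ _ h => I.tm_tmEq hk h) f.2.2).2.1
  tgt f := (Quot.lift (I.tm k) (fun _ _ h => I.tm_tmEq hk h) f.2.2).2.2
  obj_mono _ _ h := I.ty_le h
  arr_mono := by
    rintro f f' ⟨t, t', ht, ht', h⟩
    rw [← ht, ← ht']
    exact I.tm_le_of_stable hk h
  map_comp f γ := by
    obtain ⟨t, rfl⟩ := exists_cls f
    obtain ⟨γ, rfl⟩ := exists_cls_sub γ
    rw [comp_cls]
    exact congrArg Subtype.val (I.tm_subst hk t γ)
  map_proj x := rfl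
  obj_top := rfl
  map_bot b hb := by
    obtain ⟨t, rfl⟩ := exists_cls b
    intro f
    -- A least class lies below the error, which denotes the chosen bottom; so its denotation is
    -- least by soundness.
    exact C.laws.arr_trans _ _ _ (I.tm_le_of_stable hk (le_cls_iff.1 (hb (cls (.err _)))))
      (k.bot_spec _ _ f)
  obj_fn _ _ := rfl
  map_lam f := by
    obtain ⟨t, rfl⟩ := exists_cls f
    rw [lam_cls]
    rfl
  -- The formal `app` is applied to the two variables, which denote the identity substitution.
  map_app A B := congrArg Subtype.val
    ((congrArg (C.comp (C.app (I.ty A) (I.ty B))) (MultiData.sub2_proj _ _)).trans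
      (C.laws.comp_ident _))
  obj_prod _ _ := rfl
  map_pair f g := by
    obtain ⟨t, rfl⟩ := exists_cls f
    obtain ⟨v, rfl⟩ := exists_cls g
    rw [pair_cls]
    rfl
  map_fst A B := congrArg Subtype.val (C.laws.comp_sub1_ident (C.fst (I.ty A) (I.ty B)))
  map_snd A B := congrArg Subtype.val (C.laws.comp_sub1_ident (C.snd (I.ty A) (I.ty B)))
  obj_one := rfl
  map_unit _ := rfl

theorem tm_symTm (I : Interp S C k) (f : S.Sym) : (I.tm k (symTm f)).1 = I.sym f := by
  have e : Var.mapAll I.ty (P := C.Hom ((S.src f).map I.ty))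
      (fun B x => I.tm k (.var x : S.Tm (S.src f) B)) = C.identSub _ :=
    Var.mapAll_eq _ fun _ _ => rfl
  exact congrArg Subtype.val
    ((congrArg (C.comp (I.symHom ⟨f, rfl, rfl⟩)) e).trans (C.laws.comp_ident _))

end Interp

/-! ## The tautological interpretation in the syntax -/

section Syn

open PreSig

/-- The choice of casts and errors of the syntax as casts and local bottoms. -/
noncomputable def synChoice (S : GttSig.{u}) : Choice (synCat synLaws S) where
  up h := cls (.up h (.var .z))
  up_spec h := isUpcast_cls h
  dn h := cls (.dn h (.var .z))
  dn_spec h := isDowncast_cls h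
  bot _ A := cls (.err A)
  bot_spec Γ A := isBot_cls_err Γ A

theorem synChoice_stable (S : GttSig.{u}) : (synChoice S).Stable := fun γ => by
  obtain ⟨γ, rfl⟩ := exists_cls_sub γ
  exact comp_cls _ _

/-- A type denotes itself, but only by recursion on the type and not definitionally. Comparisons of
terms with their denotations in the syntax are therefore made on underlying multiarrows. -/
theorem syn_ty (S : GttSig.{u}) (A : Ty S.Base) : (synData S).ty Ty.base A = A := by
  induction A with
  | base X => rfl
  | dyn => rfl
  | fn A B ihA ihB => exact congrArg₂ Ty.fn ihA ihB
  | prod A B ihA ihB => exact congrArg₂ Ty.prod ihA ihB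
  | one => rfl

theorem syn_ctx (S : GttSig.{u}) (Γ : S.Ctx) : Γ.map ((synData S).ty Ty.base) = Γ := by
  rw [funext (syn_ty S)]
  exact List.map_id _

/-- The interpretation of a signature in its syntactic GTT category. -/
noncomputable def synPreInterp (S : GttSig.{u}) : PreInterp S.toPreSig (synCat synLaws S) where
  base := Ty.base
  tyAx A A' h := by
    rw [syn_ty, syn_ty]
    exact .ax h
  sym f := (cls (symTm f)).1
  src f := (syn_ctx S _).symm
  tgt f := (syn_ty S _).symm

theorem cls_val {S : GttSig.{u}} {Γ Γ' : S.Ctx} {A A' : Ty S.Base} (hΓ : Γ = Γ') (hA : A = A')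
    {t : S.Tm Γ A} {t' : S.Tm Γ' A'} (h : HEq t t') : (cls t).1 = (cls t').1 := by
  subst hΓ hA
  cases h
  rfl

/-- The semantic operations of the syntax are the term formers on classes, and composition is
substitution, so interpreting a term rebuilds it. Completeness and uniqueness in the universal
property both depend on this. -/
theorem synPreInterp_tm (S : GttSig.{u}) {Γ : S.Ctx} {A : Ty S.Base} (t : S.Tm Γ A) :
    ((synPreInterp S).tm (synChoice S) t).1 = (cls t).1 := by
  have hc : ∀ Γ : S.Ctx, Γ.map (synPreInterp S).ty = Γ := syn_ctx S
  have ha : ∀ A, (synPreInterp S).ty A = A := syn_ty S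
  induction t with
  | var x => exact PreFunctor.proj_val (hc _) (ha _) (Var.heq_of_idx (hc _) (x.idx_map _))
  | sym f args ih =>
    obtain ⟨f, rfl, rfl⟩ := f
    -- A symbol denotes `f(x₀, …)`, and substituting the arguments into this gives back the
    -- application.
    refine Eq.trans ?_ (congrArg Subtype.val (comp_cls (symTm f) args))
    refine PreFunctor.comp_val (hc _) (hc _) (ha _) rfl (PreMulti.sub_heq (hc _) (hc _) ?_)
    intro B B' x x'
    revert B x
    refine Var.map_cases _ fun B x hx => ?_
    obtain ⟨rfl, hx⟩ := Var.idx_inj x x' (by simpa only [Var.idx_map] using hx)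
    cases hx
    rw [Var.mapAll_map]
    exact ih _ _
  | @up Γ A A' h t ih =>
    refine Eq.trans ?_ (congrArg Subtype.val (comp_sub1_cls (.up h (.var .z)) t))
    exact MultiData.comp_sub1_val (hc _) (ha _) (ha _)
      ((synChoice S).up_val (ha _) (ha _) _ h) ih
  | @dn Γ A A' h t ih =>
    refine Eq.trans ?_ (congrArg Subtype.val (comp_sub1_cls (.dn h (.var .z)) t))
    exact MultiData.comp_sub1_val (hc _) (ha _) (ha _)
      ((synChoice S).dn_val (ha _) (ha _) _ h) ih
  | err A => exact (synChoice S).bot_val (hc _) (ha _)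
  | lam t ih =>
    refine Eq.trans ?_ (congrArg Subtype.val (lam_cls t))
    exact PreFunctor.lam_val (hc _) (ha _) (ha _) ih
  | @ap Γ A B t v ih₁ ih₂ =>
    refine Eq.trans ?_ (congrArg Subtype.val
      (comp_sub2_cls (.ap (.var (.s .z)) (.var .z) : S.Tm [A, .fn A B] B) v t))
    exact MultiData.comp_sub2_val (hc _) (ha _) (ha (.fn _ _)) (ha _) 
      ((synData S).app_val (ha _) (ha _)) ih₂ ih₁
  | pair t v ih₁ ih₂ =>
    refine Eq.trans ?_ (congrArg Subtype.val (pair_cls t v))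
    exact PreFunctor.pair_val (hc _) (ha _) (ha _) ih₁ ih₂
  | @fst Γ A B t ih =>
    refine Eq.trans ?_ (congrArg Subtype.val
      (comp_sub1_cls (.fst (.var .z) : S.Tm [.prod A B] A) t))
    exact MultiData.comp_sub1_val (hc _) (ha (.prod _ _)) (ha _)
      ((synData S).fst_val (ha A) (ha B)) ih
  | @snd Γ A B t ih =>
    refine Eq.trans ?_ (congrArg Subtype.val
      (comp_sub1_cls (.snd (.var .z) : S.Tm [.prod A B] B) t))
    exact MultiData.comp_sub1_val (hc _) (ha (.prod _ _)) (ha _)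
      ((synData S).snd_val (ha A) (ha B)) ih
  | unit => exact (synData S).unit_val (hc _)

/-- The interpretation of a signature in its syntactic GTT category validates the axioms. -/
noncomputable def synInterp (S : GttSig.{u}) : Interp S (synCat synLaws S) (synChoice S) where
  toPreInterp := synPreInterp S
  tmAx t t' h := by
    rw [PreMulti.LE, synPreInterp_tm, synPreInterp_tm]
    exact le_cls_iff.2 (.ax h)

theorem tyDyn_of_valid {S : GttSig.{u}} {A A' : Ty S.Base}
    (h : ∀ (C : GttCat.{u}) (k : Choice C) (I : Interp S C k), C.objLE (I.ty A) (I.ty A')) :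
    S.TyDyn A A' := by
  have h' := h _ _ (synInterp S)
  change S.TyDyn ((synData S).ty Ty.base A) ((synData S).ty Ty.base A') at h'
  rwa [syn_ty, syn_ty] at h'

/-- Validity is specialised to the syntactic model, where denotations are classes and their order is
derivability. -/
theorem tmDyn_of_valid {S : GttSig.{u}} {Γ Γ' : S.Ctx} {A A' : Ty S.Base} {t : S.Tm Γ A}
    {t' : S.Tm Γ' A'}
    (h : ∀ (C : GttCat.{u}) (k : Choice C) (I : Interp S C k), C.LE (I.tm k t) (I.tm k t')) :
    S.TmDyn t t' := by
  have h' := h _ _ (synInterp S)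
  rw [PreMulti.LE, synInterp, synPreInterp_tm, synPreInterp_tm] at h'
  exact le_cls_iff.1 h'

end Syn

open PreSig

theorem GttFunctor.ext_obj_arr {C : GttCat.{u}} {D : GttCat.{w}} {F G : GttFunctor C D}
    (hobj : F.obj = G.obj) (harr : F.arr = G.arr) : F = G := by
  obtain ⟨⟨_, _⟩, _⟩ := F
  obtain ⟨⟨_, _⟩, _⟩ := G
  cases hobj
  cases harr
  rfl

/-! ## The functor `U` -/

section Complete

variable {C D : GttCat.{u}} (F : GttFunctor C D)

theorem complete_ty (A : Ty C.Obj) : D.ty id (A.map F.obj) = F.obj (C.ty id A) := by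
  induction A with
  | base X => rfl
  | dyn => exact F.obj_top.symm
  | fn A B ihA ihB => exact (congrArg₂ D.fn ihA ihB).trans (F.obj_fn _ _).symm
  | prod A B ihA ihB => exact (congrArg₂ D.prod ihA ihB).trans (F.obj_prod _ _).symm
  | one => exact F.obj_one.symm

/-- The action of a functor on the first three layers of the complete signature. -/
def completePreTrans : PreTrans (completePreSig C) (completePreSig D) where
  base := F.obj
  sym f :=
    { ctx := f.ctx.map (Ty.map F.obj)
      ty := f.ty.map F.obj
      arr := F.arr f.arr
      src := by
        rw [F.src, f.src, List.map_map, List.map_map]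
        exact List.map_congr_left fun A _ => (complete_ty F A).symm
      tgt := by rw [F.tgt, f.tgt, complete_ty] }
  tyAx A A' h := by
    have h' := F.obj_mono _ _ h
    rwa [← complete_ty, ← complete_ty] at h'
  src _ := rfl
  tgt _ := rfl

theorem PreTrans.ctxDyn {S T : PreSig.{u}} (i : PreTrans S T) {Γ Γ' : S.Ctx}
    (h : S.CtxDyn Γ Γ') : T.CtxDyn (Γ.map (Ty.map i.base)) (Γ'.map (Ty.map i.base)) := by
  induction h with
  | nil => exact .nil
  | cons h _ ih => exact .cons (i.tyDyn h) ih

theorem exists_choice (C : GttCat.{u}) : Nonempty (Choice C) :=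
  (exists_stable_choice C).elim fun k _ => ⟨k⟩

/-- Order-equivalence suffices to transport the term axioms of complete signatures, since these are
inequalities. -/
theorem completePreTrans_tm (k : Choice C) (k' : Choice D) {Γ : (completePreSig C).Ctx}
    {A : Ty C.Obj} (t : (completePreSig C).Tm Γ A) :
    D.ArrEquiv (F.arr ((completeInterp C).tm k t).1)
      ((completeInterp D).tm k' ((completePreTrans F).tm t)).1 := by
  rw [← PreInterp.precomp_tm]
  exact F.tm_equiv (fun _ => rfl) (fun _ => D.laws.equiv_refl _) k k' t

/-- The action of a functor on the complete signature. -/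
def completeTrans : completeSig C ⟶ completeSig D :=
  Translation.mk (completePreTrans F) fun t t' h => by
    refine ⟨(completePreTrans F).ctxDyn h.1, (completePreTrans F).tyDyn h.2.1, fun k' => ?_⟩
    -- An axiom of the complete signature quantifies over all choices in `C`; using it requires that
    -- one exists.
    obtain ⟨k⟩ := exists_choice C
    exact D.laws.le_of_equiv (completePreTrans_tm F k k' t.2.2) (completePreTrans_tm F k k' t'.2.2)
      (F.arr_mono _ _ (h.2.2 k))

end Complete

theorem completeTrans_id (C : GttCat.{u}) :
    completeTrans (𝟙 C : C ⟶ C) = 𝟙 (completeSig C) := by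
  refine Translation.ext rfl (funext fun f => FormalArr.ext ?_ (Ty.map_id _) rfl)
  change List.map (Ty.map id) (FormalArr.ctx f) = FormalArr.ctx f
  rw [funext Ty.map_id]
  exact List.map_id _

theorem completeTrans_comp {C D E : GttCat.{u}} (F : C ⟶ D) (G : D ⟶ E) :
    completeTrans (F ≫ G) = completeTrans F ≫ completeTrans G := by
  refine Translation.ext rfl (funext fun f => FormalArr.ext ?_
    (Ty.map_map (catMap F).obj (catMap G).obj (FormalArr.ty f)).symm rfl)
  refine Eq.trans ?_ List.map_map.symm
  exact List.map_congr_left fun A _ => (Ty.map_map (catMap F).obj (catMap G).obj A).symm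

/-! ## The functor `GTT` -/

section SynFunctor

variable {S T R : GttSig.{u}}

/-- The interpretation of a signature in the syntax of another one given by a translation. -/
noncomputable def Translation.synInterp (i : Translation S T) :
    Interp S (synCat synLaws T) (synChoice T) where
  toPreInterp := (synPreInterp T).precomp i.toPreTrans
  tmAx t t' h := by
    rw [PreMulti.LE, PreInterp.precomp_tm, PreInterp.precomp_tm, synPreInterp_tm, synPreInterp_tm]
    exact le_cls_iff.2 (.ax (i.tmAx t t' h))

/-- The action of a translation on the syntax. -/
noncomputable def Translation.synFunctor (i : Translation S T) :
    GttFunctor (synCat synLaws S) (synCat synLaws T) :=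
  i.synInterp.functor (synChoice_stable T)

theorem Translation.synFunctor_obj (i : Translation S T) : i.synFunctor.obj = Ty.map i.base :=
  funext fun A => ((synPreInterp T).precomp_ty i.toPreTrans A).trans (syn_ty T _)

/-- The morphism was built semantically, from an interpretation in the syntax of `T`; since terms
denote their classes there, it is the syntactic translation. Functoriality is then that of
`PreTrans.tm`. -/
theorem Translation.synFunctor_arr (i : Translation S T) {Γ : S.Ctx} {A : Ty S.Base}
    (t : S.Tm Γ A) : i.synFunctor.arr (cls t).1 = (cls (S := T) (i.tm t)).1 :=
  ((synPreInterp T).precomp_tm i.toPreTrans _ t).trans (synPreInterp_tm T _)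

theorem exists_cls_arr (f : (synMulti S).Arr) :
    ∃ (Γ : S.Ctx) (A : Ty S.Base) (t : S.Tm Γ A), (cls t).1 = f := by
  obtain ⟨Γ, A, q⟩ := f
  obtain ⟨t, rfl⟩ := Quot.exists_rep q
  exact ⟨Γ, A, t, rfl⟩

theorem synFunctor_id (S : GttSig.{u}) :
    Translation.synFunctor (𝟙 S : S ⟶ S) = GttFunctor.ident (synCat synLaws S) := by
  refine GttFunctor.ext_obj_arr ?_ (funext fun f => ?_)
  · rw [Translation.synFunctor_obj]
    exact funext Ty.map_id
  · obtain ⟨Γ, A, t, rfl⟩ := exists_cls_arr f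
    rw [Translation.synFunctor_arr]
    refine cls_val ?_ (Ty.map_id _) (PreTrans.tm_ident t)
    exact (congrArg (List.map · Γ) (funext Ty.map_id)).trans (List.map_id _)

theorem synFunctor_comp (i : S ⟶ T) (j : T ⟶ R) :
    Translation.synFunctor (i ≫ j) =
      (Translation.synFunctor i).comp (Translation.synFunctor j) := by
  refine GttFunctor.ext_obj_arr ?_ (funext fun f => ?_)
  · refine (Translation.synFunctor_obj _).trans (Eq.trans ?_ (congrArg₂ Function.comp
      (Translation.synFunctor_obj j) (Translation.synFunctor_obj i)).symm)
    exact funext fun A => (Ty.map_map (sigMap i).base (sigMap j).base A).symm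
  · obtain ⟨Γ, A, t, rfl⟩ := exists_cls_arr f
    refine (Translation.synFunctor_arr _ t).trans (Eq.trans ?_
      ((congrArg (Translation.synFunctor j).arr (Translation.synFunctor_arr i t)).trans
        (Translation.synFunctor_arr j _)).symm)
    refine cls_val (S := R) ?_ (Ty.map_map (sigMap i).base (sigMap j).base A).symm
      (PreTrans.tm_comp (sigMap i) (sigMap j) t)
    rw [List.map_map]
    exact List.map_congr_left fun A _ => (Ty.map_map (sigMap i).base (sigMap j).base A).symm

end SynFunctor

/-! ## The unit -/

/-- The unit on the first three layers of a signature. -/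
noncomputable def unitPreTrans (S : GttSig.{u}) :
    PreTrans S.toPreSig (completePreSig (synCat synLaws S)) where
  base := Ty.base
  sym f :=
    { ctx := (S.src f).map (Ty.map Ty.base)
      ty := (S.tgt f).map Ty.base
      arr := (cls (symTm f)).1
      src := by
        rw [List.map_map]
        exact (List.map_id _).symm.trans (List.map_congr_left fun A _ =>
          ((GttCat.ty_map (synCat synLaws S) Ty.base id A).trans (syn_ty S A)).symm)
      tgt := ((GttCat.ty_map (synCat synLaws S) Ty.base id _).trans (syn_ty S _)).symm }
  tyAx A A' h := by
    change (synCat synLaws S).objLE ((synCat synLaws S).ty id _) ((synCat synLaws S).ty id _)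
    rw [GttCat.ty_map, GttCat.ty_map]
    exact (synPreInterp S).tyAx A A' h
  src _ := rfl
  tgt _ := rfl

/-- The unit of the adjunction between signatures and GTT categories. -/
noncomputable def unitTrans (S : GttSig.{u}) : S ⟶ completeSig (synCat synLaws S) :=
  Translation.mk (unitPreTrans S) fun t t' h => by
    refine ⟨(unitPreTrans S).ctxDyn (S.tmAx_ctx _ _ h),
      (unitPreTrans S).tyDyn (S.tmAx_ty _ _ h), fun k => ?_⟩
    -- The axiom is known for the formal casts and errors, while the complete signature demands it
    -- for every choice. The equations `e` identify the translated terms' denotations with those of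
    -- the tautological interpretation.
    have h' := ((synInterp S).changeChoice k).tmAx t t' h
    have e := fun t : S.Tot =>
      (completeInterp (synCat synLaws S)).precomp_tm (unitPreTrans S) k t.2.2
    exact (congrArg₂ (synMulti S).arrLE (e t) (e t')).mp h'

theorem unitTrans_naturality {S T : GttSig.{u}} (i : S ⟶ T) :
    unitTrans S ≫ completeTrans (Translation.synFunctor i) = i ≫ unitTrans T := by
  have hobj := Translation.synFunctor_obj i
  have ht : ∀ A : Ty S.Base, (A.map Ty.base).map (Translation.synFunctor i).obj =
      (A.map (sigMap i).base).map Ty.base := fun A => by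
    rw [Ty.map_map, Ty.map_map, hobj]
    rfl
  refine Translation.ext ?_ (funext fun f => FormalArr.ext ?_ ?_ ?_)
  · exact funext fun X => congrFun hobj (.base X)
  · change ((S.src f).map (Ty.map Ty.base)).map (Ty.map (Translation.synFunctor i).obj) =
      (T.src ((sigMap i).sym f)).map (Ty.map Ty.base)
    rw [(sigMap i).src, List.map_map, List.map_map]
    exact List.map_congr_left fun A _ => ht A
  · change ((S.tgt f).map Ty.base).map (Translation.synFunctor i).obj =
      (T.tgt ((sigMap i).sym f)).map Ty.base
    rw [(sigMap i).tgt]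
    exact ht _
  -- It remains to see that `f(x₀, …)` is translated to the image of `f` applied to the variables of
  -- the translated source.
  · refine (Translation.synFunctor_arr i (symTm f)).trans ?_
    refine cls_val ((sigMap i).src f).symm ((sigMap i).tgt f).symm ?_
    refine Tm.sym_heq ((sigMap i).src f).symm ((sigMap i).src f).symm ((sigMap i).tgt f).symm
      rfl ?_
    have e : Var.mapAll (Ty.map (sigMap i).base)
        (P := T.Tm ((S.src f).map (Ty.map (sigMap i).base)))
        (fun B x => (sigMap i).tm (.var x : S.Tm (S.src f) B)) = fun _ x => .var x :=
      Var.mapAll_eq _ fun _ _ => rfl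
    refine (heq_of_eq e).trans ?_
    rw [(sigMap i).src f]

/-! ## The universal property -/

section Universal

variable {S : GttSig.{u}} {C : GttCat.{u}}

/-- The interpretation given by a translation into a complete signature. -/
def Translation.toInterp (i : Translation S (completeSig C)) (k : Choice C) : Interp S C k where
  toPreInterp := i.toPreInterp
  tmAx t t' h := by
    have e := fun t : S.Tot => (completeInterp C).precomp_tm i.toPreTrans k t.2.2
    exact (congrArg₂ C.arrLE (e t) (e t')).mpr ((i.tmAx t t' h).2.2 k)

/-- The factorisation is strict because generators involve neither casts nor errors: `f(x₀, …)`
denotes the multiarrow of `f` composed with an identity substitution. -/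
theorem unitTrans_comp_functor (i : S ⟶ completeSig C) {k : Choice C} (hk : k.Stable) :
    unitTrans S ≫ completeTrans ((Translation.toInterp i k).functor hk) = i := by
  refine Translation.ext rfl (funext fun f => FormalArr.ext ?_ ?_ ?_)
  · refine Eq.trans ?_ ((sigMap i).src f).symm
    refine List.map_map.trans (List.map_congr_left fun A _ => ?_)
    exact Ty.map_map _ _ A
  · exact (Ty.map_map _ _ _).trans ((sigMap i).tgt f).symm
  · exact (Translation.toInterp i k).tm_symTm f

/-- Each class is the denotation of its term in the tautological interpretation, so `tm_equiv`
compares its image under `F` with the denotation given by `i`. On arrows only order-equivalence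
results, as `F` need not respect the choice `k`. On objects the structure is preserved strictly,
which gives equality. -/
theorem functor_unique (i : S ⟶ completeSig C) {k : Choice C} (hk : k.Stable)
    (F : synCat synLaws S ⟶ C)
    (h : Translation.Equiv (unitTrans S ≫ completeTrans F) i) :
    GttFunctor.Equiv F ((Translation.toInterp i k).functor hk) := by
  have hb : ∀ X, (catMap F).obj ((synPreInterp S).base X) =
      (Translation.toPreInterp i).base X := congrFun h.1
  refine ⟨funext fun A => ?_, fun f => ?_⟩
  · refine (congrArg (catMap F).obj (syn_ty S A)).symm.trans ?_
    exact GttFunctor.ty_eq F (I := synPreInterp S) (I' := Translation.toPreInterp i) hb A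
  · obtain ⟨Γ, A, t, rfl⟩ := exists_cls_arr f
    have h' := GttFunctor.tm_equiv F (I := synPreInterp S) (I' := Translation.toPreInterp i) hb
      h.2 (synChoice S) k t
    rw [synPreInterp_tm] at h'
    exact h'

end Universal

end GTT

theorem mainTheorem9 :
    -- Soundness of the interpretation in any GTT category.
    (∀ (S : GttSig.{u}) (C : GttCat.{w}) (k : Choice C) (I : Interp S C k),
      (∀ A A' : Ty S.Base, S.TyDyn A A' → C.objLE (I.ty A) (I.ty A')) ∧
      (∀ (Γ : S.Ctx) (A : Ty S.Base) (t : S.Tm Γ A),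
        C.src (I.tm k t).1 = Γ.map I.ty ∧ C.tgt (I.tm k t).1 = I.ty A) ∧
      (∀ (Γ Γ' : S.Ctx) (A A' : Ty S.Base) (t : S.Tm Γ A) (t' : S.Tm Γ' A'),
        S.TmDyn t t' → C.LE (I.tm k t) (I.tm k t'))) ∧
    -- Completeness.
    (∀ S : GttSig.{u},
      (∀ A A' : Ty S.Base,
        (∀ (C : GttCat.{u}) (k : Choice C) (I : Interp S C k), C.objLE (I.ty A) (I.ty A')) →
        S.TyDyn A A') ∧
      (∀ (Γ Γ' : S.Ctx) (A A' : Ty S.Base) (t : S.Tm Γ A) (t' : S.Tm Γ' A'),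
        S.CtxDyn Γ Γ' → S.TyDyn A A' →
        (∀ (C : GttCat.{u}) (k : Choice C) (I : Interp S C k), C.LE (I.tm k t) (I.tm k t')) →
        S.TmDyn t t')) ∧
    -- The syntax is a GTT category, and it is left adjoint to the complete signature.
    ∃ (h : ∀ S : GttSig.{u}, (synData S).IsGttCat)
      (U : ∀ {C D : GttCat.{u}}, (C ⟶ D) → (completeSig C ⟶ completeSig D))
      (G : ∀ {S T : GttSig.{u}}, (S ⟶ T) → (synCat h S ⟶ synCat h T))
      (η : ∀ S : GttSig.{u}, S ⟶ completeSig (synCat h S)),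
      -- `U` is a functor, acting on the objects and multiarrows as the given functor does.
      (∀ {C D : GttCat.{u}} (F : C ⟶ D), (sigMap (U F)).base = (catMap F).obj ∧
        ∀ f : FormalArr C, symArr (U F) f = (catMap F).arr f.arr) ∧
      (∀ C : GttCat.{u}, U (𝟙 C) = 𝟙 (completeSig C)) ∧
      (∀ {C D E : GttCat.{u}} (F : C ⟶ D) (F' : D ⟶ E), U (F ≫ F') = U F ≫ U F') ∧
      -- The syntax is a functor, acting by the translation of types and terms.
      (∀ {S T : GttSig.{u}} (i : S ⟶ T), (catMap (G i)).obj = Ty.map (sigMap i).base ∧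
        ∀ (Γ : S.Ctx) (A : Ty S.Base) (t : S.Tm Γ A),
          (catMap (G i)).arr (cls t).1 = (cls (S := T) ((sigMap i).tm t)).1) ∧
      (∀ S : GttSig.{u}, G (𝟙 S) = 𝟙 (synCat h S)) ∧
      (∀ {S T R : GttSig.{u}} (i : S ⟶ T) (j : T ⟶ R), G (i ≫ j) = G i ≫ G j) ∧
      -- The unit sends every generator to itself, and it is natural.
      (∀ S : GttSig.{u}, (∀ X : S.Base, (sigMap (η S)).base X = Ty.base X) ∧
        ∀ f : S.Sym, symArr (η S) f = (cls (symTm f)).1) ∧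
      (∀ {S T : GttSig.{u}} (i : S ⟶ T), η S ≫ U (G i) = i ≫ η T) ∧
      -- Every translation `i` into a complete signature factors through the unit by the
      -- interpretation given by `i`, uniquely up to order-equivalence on multiarrows.
      (∀ (S : GttSig.{u}) (C : GttCat.{u}) (i : S ⟶ completeSig C),
        ∃ F : synCat h S ⟶ C,
          η S ≫ U F = i ∧
          ((catMap F).obj = (Translation.toPreInterp i).ty ∧
            ∀ (k : Choice C) (Γ : S.Ctx) (A : Ty S.Base) (t : S.Tm Γ A),
              C.ArrEquiv ((catMap F).arr (cls t).1) ((Translation.toPreInterp i).tm k t).1) ∧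
          ∀ F' : synCat h S ⟶ C,
            Translation.Equiv (η S ≫ U F') i → GttFunctor.Equiv F' F) := by
  refine ⟨fun S C k I => ⟨fun A A' h => I.ty_le h, fun Γ A t => (I.tm k t).2,
      fun Γ Γ' A A' t t' h => I.tm_le h⟩,
    fun S => ⟨fun A A' h => tyDyn_of_valid h, fun Γ Γ' A A' t t' _ _ h => tmDyn_of_valid h⟩,
    synLaws, fun F => completeTrans F, fun i => Translation.synFunctor i, unitTrans,
    fun F => ⟨rfl, fun f => rfl⟩, completeTrans_id, completeTrans_comp,
    fun i => ⟨Translation.synFunctor_obj i, fun Γ A t => Translation.synFunctor_arr i t⟩,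
    synFunctor_id, synFunctor_comp, fun S => ⟨fun X => rfl, fun f => rfl⟩,
    unitTrans_naturality, fun S C i => ?_⟩
  -- The morphism is built from one stable choice; denotations under any other choice are
  -- order-equivalent to its values.
  obtain ⟨k, hk⟩ := exists_stable_choice C
  exact ⟨(Translation.toInterp i k).functor hk, unitTrans_comp_functor i hk,
    ⟨rfl, fun k' Γ A t => (Translation.toPreInterp i).tm_equiv_of_choice k k' t⟩,
    functor_unique i hk⟩
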